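/- Let $n\in\mathbb N$ and let $p$ be a real number with $1<p<n$ and $\frac{2n}{n+2}\le p\le 2$; put $q=\frac{np}{n-p}$ and $\ell^*_p=\frac{n-p}{p-1}$. Let $K:[0,\infty)\to(0,\infty)$ be continuous on $[0,\infty)$ and $C^1$ on $(0,\infty)$, and suppose that there are constants $A,B,\ell>0$ such that $$K(r)=A+Br^{\ell}+h(r)\quad (r\ge 0),\qquad \lim_{r\to0^+}\frac{|h(r)|+r|h'(r)|}{r^{\ell}}=0 .$$ For $R>0$ consider the problem $$\operatorname{div}\bigl(\nabla u\,|\nabla u|^{p-2}\bigr)+K(|x|)\,u\,|u|^{q-2}=0\ \text{ and }\ u>0\ \text{ for } |x|<R,\qquad u=0\ \text{ for } |x|=R, \tag{$P_R$}$$ where $x\in\mathbb R^n$. A radial solution of $(P_R)$ is a radial function $u$ that is continuous on the closed ball $\{|x|\le R\}$ and $C^1$ on the open ball $\{|x|<R\}$, such that $\nabla u\,|\nabla u|^{p-2}$ (read as $0$ where $\nabla u=0$) is differentiable on the open ball and $(P_R)$ holds pointwise. (i) If $\ell<\ell^*_p$, then $(P_R)$ has a radial solution for every $R>0$. (ii)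 If $\ell\ge\ell^*_p$, then there is $R_0>0$ such that $(P_R)$ has no radial solution for any $0<R<R_0$. -/

import Mathlib

open Set Filter Topology

noncomputable section

namespace PLaplace

/-- The divergence `∑ i, ∂ᵢ Vᵢ` of a vector field on `ℝⁿ`. -/
def divergence {n : ℕ} (V : EuclideanSpace ℝ (Fin n) → EuclideanSpace ℝ (Fin n))
    (x : EuclideanSpace ℝ (Fin n)) : ℝ :=
  ∑ i : Fin n, fderiv ℝ V x (EuclideanSpace.single i 1) i

/-- The vector field `∇u |∇u|^{p-2}`, equal to `0` where `∇u = 0`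
(the factor `∇u` makes the value of the real power at `0` irrelevant). -/
def flux {n : ℕ} (p : ℝ) (u : EuclideanSpace ℝ (Fin n) → ℝ)
    (x : EuclideanSpace ℝ (Fin n)) : EuclideanSpace ℝ (Fin n) :=
  ‖gradient u x‖ ^ (p - 2) • gradient u x

/-- The `p`-Laplace operator `div (∇u |∇u|^{p-2})`. -/
def pLaplacian {n : ℕ} (p : ℝ) (u : EuclideanSpace ℝ (Fin n) → ℝ)
    (x : EuclideanSpace ℝ (Fin n)) : ℝ :=
  divergence (flux p u) x

/-- The critical Sobolev exponent `np / (n - p)`. -/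
def critExp (n : ℕ) (p : ℝ) : ℝ := n * p / (n - p)

/-- The threshold `(n - p) / (p - 1)` for the order of flatness. -/
def flatThreshold (n : ℕ) (p : ℝ) : ℝ := (n - p) / (p - 1)

/-- `K : [0,∞) → (0,∞)` is continuous, and continuously differentiable on `(0,∞)`.
Only the values of `K` on `[0,∞)` matter. Differentiability at the endpoint `0` is not
imposed, since it would exclude all orders of flatness `ℓ < 1`. -/
structure Admissible (K : ℝ → ℝ) : Prop where
  pos : ∀ r, 0 ≤ r → 0 < K r
  cont : ContinuousOn K (Ici 0)
  contDiff : ContDiffOn ℝ 1 K (Ioi 0)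

/-- `K(r) = A + B r^ℓ + h(r)` with `A, B, ℓ > 0` and
`(|h(r)| + r |h'(r)|) / r^ℓ → 0` as `r → 0⁺`. -/
def HasFlatness (K : ℝ → ℝ) (ℓ : ℝ) : Prop :=
  0 < ℓ ∧ ∃ A B : ℝ, 0 < A ∧ 0 < B ∧ ∃ h : ℝ → ℝ,
    (∀ r, 0 ≤ r → K r = A + B * r ^ ℓ + h r) ∧
    Tendsto (fun r => (|h r| + r * |deriv h r|) / r ^ ℓ) (𝓝[>] 0) (𝓝 0)

/-- `u` is a positive radial solution of the critical Dirichlet problem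
`Δ_p u + K(|x|) u |u|^{q-2} = 0` in `|x| < R`, `u > 0` in `|x| < R`, `u = 0` on `|x| = R`.
The equation is understood classically: `u` is `C¹` and `∇u |∇u|^{p-2}` is differentiable
in the open ball (including the centre), and `u` is continuous on the closed ball. -/
structure IsPosRadialSolution (n : ℕ) (p : ℝ) (K : ℝ → ℝ) (R : ℝ)
    (u : EuclideanSpace ℝ (Fin n) → ℝ) : Prop where
  radial : ∀ x ∈ Metric.closedBall (0 : EuclideanSpace ℝ (Fin n)) R,
    ∀ y ∈ Metric.closedBall (0 : EuclideanSpace ℝ (Fin n)) R, ‖x‖ = ‖y‖ → u x = u y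
  cont : ContinuousOn u (Metric.closedBall 0 R)
  contDiff : ContDiffOn ℝ 1 u (Metric.ball 0 R)
  flux_diff : DifferentiableOn ℝ (flux p u) (Metric.ball 0 R)
  eqn : ∀ x ∈ Metric.ball (0 : EuclideanSpace ℝ (Fin n)) R,
    pLaplacian p u x + K ‖x‖ * (u x * |u x| ^ (critExp n p - 2)) = 0
  pos : ∀ x ∈ Metric.ball (0 : EuclideanSpace ℝ (Fin n)) R, 0 < u x
  boundary : ∀ x ∈ Metric.sphere (0 : EuclideanSpace ℝ (Fin n)) R, u x = 0

end PLaplace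

end

/-!
A radial solution is `u(x) = U(|x|)` with flux `-b(|x|) x`, where `U' = -(r b)^σ`,
`σ = 1 / (p - 1)`, and `b` is `r^{-n} ∫₀^r t^{n-1} K U^{q-1}`. Near the origin `K` is increasing, so
the Pohozaev function is nondecreasing, and its positivity makes `U` lie below the explicit bubble
with the same height `d = U(0)`.

If `ℓ ≥ ℓ*`, the bubble bound shows that the Pohozaev function is `O(d^{-(σ+1)})`. At a zero `R`
of `U` it reduces to its kinetic part, which is at least of order `R^{-ℓ*} d^{-(σ+1)}`. Hence `R`
cannot be small.

If `ℓ < ℓ*`, the Pohozaev function is at least of order `d^{-αℓ}`, `α = p / (n - p)`, outside the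
core of radius `d^{-α}`, whereas for a solution positive on a fixed interval it is
`O(d^{-(σ+1)})`, and `σ + 1 = α ℓ*`. So for large `d` the solution vanishes before any given `R`.
For small `d` it stays positive, because the equation is superlinear, and since `U(R)` depends
continuously on `d` some `d` gives `U(R) = 0`.
-/

noncomputable section

namespace PLaplace

/-! ### Radial profiles and the Pohozaev function -/

section Comparison

variable {f g f' g' : ℝ → ℝ} {a b c r : ℝ}

theorem monotoneOn_Ioo_of_hasDerivAt_nonneg (hf : ∀ t ∈ Ioo a b, HasDerivAt f (f' t) t)
    (hf' : ∀ t ∈ Ioo a b, 0 ≤ f' t) : MonotoneOn f (Ioo a b) :=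
  monotoneOn_of_hasDerivWithinAt_nonneg (convex_Ioo a b)
    (fun t ht => (hf t ht).continuousAt.continuousWithinAt)
    (by simpa only [interior_Ioo] using fun t ht => (hf t ht).hasDerivWithinAt)
    (by simpa only [interior_Ioo] using hf')

theorem lt_of_hasDerivAt_pos_of_tendsto (hr : r ∈ Ioo a b)
    (hf : ∀ t ∈ Ioo a b, HasDerivAt f (f' t) t) (hf' : ∀ t ∈ Ioo a b, 0 < f' t)
    (hc : Tendsto f (𝓝[>] a) (𝓝 c)) : c < f r := by
  have hmono : StrictMonoOn f (Ioo a b) :=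
    strictMonoOn_of_deriv_pos (convex_Ioo a b)
      (fun t ht => (hf t ht).continuousAt.continuousWithinAt)
      (by simpa only [interior_Ioo] using fun t ht => (hf t ht).deriv.symm ▸ hf' t ht)
  obtain ⟨s, has, hsr⟩ := exists_between hr.1
  have hs : s ∈ Ioo a b := ⟨has, hsr.trans hr.2⟩
  refine (le_of_tendsto hc ?_).trans_lt (hmono hs hr hsr)
  filter_upwards [Ioo_mem_nhdsGT has] with t ht
  exact (hmono ⟨ht.1, ht.2.trans hs.2⟩ hs ht.2).le

theorem le_of_hasDerivAt_le_of_tendsto (hr : r ∈ Ioo a b)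
    (hf : ∀ t ∈ Ioo a b, HasDerivAt f (f' t) t) (hg : ∀ t ∈ Ioo a b, HasDerivAt g (g' t) t)
    (hle : ∀ t ∈ Ioo a b, t ≤ r → f' t ≤ g' t)
    (hfc : Tendsto f (𝓝[>] a) (𝓝 c)) (hgc : Tendsto g (𝓝[>] a) (𝓝 c)) : f r ≤ g r := by
  have hsub : ∀ t ∈ Ioc a r, t ∈ Ioo a b := fun t ht => ⟨ht.1, ht.2.trans_lt hr.2⟩
  have hd : ∀ t ∈ Ioc a r, HasDerivAt (g - f) (g' t - f' t) t :=
    fun t ht => (hg t (hsub t ht)).sub (hf t (hsub t ht))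
  have hmono : MonotoneOn (g - f) (Ioc a r) :=
    monotoneOn_of_hasDerivWithinAt_nonneg (convex_Ioc a r)
      (fun t ht => (hd t ht).continuousAt.continuousWithinAt)
      (fun t ht => (hd t (interior_subset ht)).hasDerivWithinAt)
      (fun t ht => sub_nonneg.2 <|
        hle t (hsub t (interior_subset ht)) (interior_subset ht).2)
  have h0 : 0 ≤ (g - f) r := by
    refine le_of_tendsto (sub_self c ▸ hgc.sub hfc) ?_
    filter_upwards [Ioo_mem_nhdsGT hr.1] with t ht
    exact hmono ⟨ht.1, ht.2.le⟩ ⟨hr.1, le_rfl⟩ ht.2.le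
  exact sub_nonneg.1 h0

end Comparison

theorem tendsto_pow_mul_const_zero {n : ℕ} (hn : n ≠ 0) (c : ℝ) :
    Tendsto (fun r : ℝ => r ^ n * c) (𝓝[>] 0) (𝓝 0) := by
  have h : Continuous fun r : ℝ => r ^ n * c := by fun_prop
  simpa [hn] using h.continuousWithinAt (s := Ioi 0) (x := 0) |>.tendsto

theorem tendsto_const_mul_rpow_zero (c : ℝ) {s : ℝ} (hs : 0 < s) :
    Tendsto (fun r : ℝ => c * r ^ s) (𝓝[>] 0) (𝓝 0) := by
  have h : Continuous fun r : ℝ => c * r ^ s :=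
    continuous_const.mul (Real.continuous_rpow_const hs.le)
  simpa [Real.zero_rpow hs.ne'] using h.continuousWithinAt (s := Ioi 0) (x := 0) |>.tendsto

theorem hasDerivAt_const_mul_rpow_add_one (c s : ℝ) {r : ℝ} (hr : r ≠ 0) :
    HasDerivAt (fun t : ℝ => c * t ^ (s + 1)) (c * ((s + 1) * r ^ s)) r := by
  simpa using (Real.hasDerivAt_rpow_const (p := s + 1) (Or.inl hr)).const_mul c

theorem hasDerivAt_pow_mul_const {n : ℕ} (c r : ℝ) :
    HasDerivAt (fun t : ℝ => t ^ n * c) (r ^ (n - 1) * (n * c)) r :=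
  ((hasDerivAt_pow n r).mul_const c).congr_deriv (by ring)

theorem hasDerivAt_pow_mul {n : ℕ} (hn : n ≠ 0) {b : ℝ → ℝ} {g r : ℝ} (hr : r ≠ 0)
    (hb : HasDerivAt b ((g - n * b r) / r) r) :
    HasDerivAt (fun t => t ^ n * b t) (r ^ (n - 1) * g) r := by
  refine ((hasDerivAt_pow n r).mul hb).congr_deriv ?_
  rw [← pow_sub_one_mul hn]
  field_simp
  ring

theorem pos_of_hasDerivAt_of_tendsto_pow_mul {n : ℕ} (hn : n ≠ 0) {b g : ℝ → ℝ} {R r : ℝ}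
    (hr : r ∈ Ioo 0 R) (hb : ∀ t ∈ Ioo 0 R, HasDerivAt b ((g t - n * b t) / t) t)
    (hg : ∀ t ∈ Ioo 0 R, 0 < g t) (hlim : Tendsto (fun t => t ^ n * b t) (𝓝[>] 0) (𝓝 0)) :
    0 < b r :=
  pos_of_mul_pos_right
    (lt_of_hasDerivAt_pos_of_tendsto (f := fun t => t ^ n * b t) hr
      (fun t ht => hasDerivAt_pow_mul hn ht.1.ne' (hb t ht))
      (fun t ht => mul_pos (pow_pos ht.1 _) (hg t ht)) hlim)
    (pow_nonneg hr.1.le n)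

/-- The exponents of the radial critical problem, encoded by `σ = 1 / (p - 1)` and
`α = p / (n - p)`. In these terms the critical exponent is `n * α`, the flatness threshold is
`(σ + 1) / α`, and criticality is the polynomial identity `rel`. -/
structure CriticalExponents (n : ℕ) (σ α : ℝ) : Prop where
  σ_pos : 0 < σ
  α_pos : 0 < α
  rel : (α + 1) * (σ + 1) = n * α * σ

namespace CriticalExponents

variable {n : ℕ} {σ α : ℝ}

theorem natCast_pos (E : CriticalExponents n σ α) : 0 < (n : ℝ) := by
  have hα := E.α_pos
  have hσ := E.σ_pos
  by_contra! hn
  have : (n : ℝ) = 0 := le_antisymm hn n.cast_nonneg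
  have hrel := E.rel
  rw [this] at hrel
  nlinarith [mul_pos hα hσ]

theorem ne_zero (E : CriticalExponents n σ α) : n ≠ 0 := by
  exact_mod_cast E.natCast_pos.ne'

theorem critical_pos (E : CriticalExponents n σ α) : 0 < n * α :=
  mul_pos E.natCast_pos E.α_pos

theorem one_lt_natCast (E : CriticalExponents n σ α) : 1 < (n : ℝ) := by
  have hασ := mul_pos E.α_pos E.σ_pos
  nlinarith [E.σ_pos, E.α_pos, E.rel]

theorem one_lt_critical (E : CriticalExponents n σ α) : 1 < n * α := by
  nlinarith [E.σ_pos, E.α_pos, E.rel, mul_pos E.σ_pos E.α_pos]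

theorem one_lt_critical_sub_one_mul (E : CriticalExponents n σ α) : 1 < (n * α - 1) * σ := by
  nlinarith [E.rel, E.α_pos, E.σ_pos]

theorem natCast_add_threshold (E : CriticalExponents n σ α) :
    n + (σ + 1) / α = (σ + 1) * (n - 1) := by
  have := E.α_pos
  field_simp
  linear_combination E.rel

end CriticalExponents

/-- A positive solution `U` of the radial equation on `(0, R)` with `U(0⁺) = d`, written as a
first order system for `U` and `b`, where `|U'| ^ (1 / σ) = r * b r`. The vector field
`∇u |∇u|^{p-2}` is then `-b(|x|) x`, and dividing by `r` makes `b` regular at the centre. -/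
structure RadialProfile (n : ℕ) (σ α : ℝ) (K : ℝ → ℝ) (R d : ℝ) (U b : ℝ → ℝ) : Prop where
  K_pos : ∀ r ∈ Ioo 0 R, 0 < K r
  U_tendsto : Tendsto U (𝓝[>] 0) (𝓝 d)
  w_tendsto : Tendsto (fun r => r ^ n * b r) (𝓝[>] 0) (𝓝 0)
  U_pos : ∀ r ∈ Ioo 0 R, 0 < U r
  U_deriv : ∀ r ∈ Ioo 0 R, HasDerivAt U (-(r * b r) ^ σ) r
  b_deriv : ∀ r ∈ Ioo 0 R, HasDerivAt b ((K r * U r ^ (n * α - 1) - n * b r) / r) r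

/-- A nondecreasing weight on `(0, R)` with values in `[A, M]`, where `A > 0`. -/
structure MonotoneWeight (K : ℝ → ℝ) (R A M : ℝ) : Prop where
  A_pos : 0 < A
  lower : ∀ r ∈ Ioo 0 R, A ≤ K r
  upper : ∀ r ∈ Ioo 0 R, K r ≤ M
  differentiableAt : ∀ r ∈ Ioo 0 R, DifferentiableAt ℝ K r
  deriv_nonneg : ∀ r ∈ Ioo 0 R, 0 ≤ deriv K r

theorem MonotoneWeight.mono {K : ℝ → ℝ} {R R' A M : ℝ} (W : MonotoneWeight K R A M)
    (hR : R' ≤ R) : MonotoneWeight K R' A M where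
  A_pos := W.A_pos
  lower r hr := W.lower r ⟨hr.1, hr.2.trans_le hR⟩
  upper r hr := W.upper r ⟨hr.1, hr.2.trans_le hR⟩
  differentiableAt r hr := W.differentiableAt r ⟨hr.1, hr.2.trans_le hR⟩
  deriv_nonneg r hr := W.deriv_nonneg r ⟨hr.1, hr.2.trans_le hR⟩

namespace RadialProfile

variable {n : ℕ} {σ α : ℝ} {K : ℝ → ℝ} {R R' d r A M : ℝ} {U b : ℝ → ℝ}

theorem mono (h : RadialProfile n σ α K R d U b) (hR : R' ≤ R) :
    RadialProfile n σ α K R' d U b where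
  K_pos r hr := h.K_pos r ⟨hr.1, hr.2.trans_le hR⟩
  U_tendsto := h.U_tendsto
  w_tendsto := h.w_tendsto
  U_pos r hr := h.U_pos r ⟨hr.1, hr.2.trans_le hR⟩
  U_deriv r hr := h.U_deriv r ⟨hr.1, hr.2.trans_le hR⟩
  b_deriv r hr := h.b_deriv r ⟨hr.1, hr.2.trans_le hR⟩

theorem w_deriv (h : RadialProfile n σ α K R d U b) (hn : n ≠ 0) (hr : r ∈ Ioo 0 R) :
    HasDerivAt (fun t => t ^ n * b t) (r ^ (n - 1) * (K r * U r ^ (n * α - 1))) r :=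
  hasDerivAt_pow_mul hn hr.1.ne' (h.b_deriv r hr)

theorem source_pos (h : RadialProfile n σ α K R d U b) (hr : r ∈ Ioo 0 R) :
    0 < K r * U r ^ (n * α - 1) :=
  mul_pos (h.K_pos r hr) (Real.rpow_pos_of_pos (h.U_pos r hr) _)

theorem w_mono (h : RadialProfile n σ α K R d U b) (hn : n ≠ 0) :
    MonotoneOn (fun t => t ^ n * b t) (Ioo 0 R) :=
  monotoneOn_Ioo_of_hasDerivAt_nonneg (fun _ ht => h.w_deriv hn ht)
    fun _ ht => (mul_pos (pow_pos ht.1 _) (h.source_pos ht)).le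

theorem b_pos (h : RadialProfile n σ α K R d U b) (hn : n ≠ 0) (hr : r ∈ Ioo 0 R) : 0 < b r :=
  pos_of_hasDerivAt_of_tendsto_pow_mul hn hr h.b_deriv (fun _ ht => h.source_pos ht) h.w_tendsto

theorem slope_pos (h : RadialProfile n σ α K R d U b) (hn : n ≠ 0) (hr : r ∈ Ioo 0 R) :
    0 < r * b r :=
  mul_pos hr.1 (h.b_pos hn hr)

theorem U_antitone (h : RadialProfile n σ α K R d U b) (hn : n ≠ 0) :
    AntitoneOn U (Ioo 0 R) := by
  have hneg : MonotoneOn (fun t => -U t) (Ioo 0 R) :=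
    monotoneOn_Ioo_of_hasDerivAt_nonneg (fun t ht => (h.U_deriv t ht).neg) fun t ht => by
      rw [neg_neg]
      exact Real.rpow_nonneg (h.slope_pos hn ht).le _
  exact fun s hs t ht hst => neg_le_neg_iff.1 (hneg hs ht hst)

theorem U_le (h : RadialProfile n σ α K R d U b) (hn : n ≠ 0) (hr : r ∈ Ioo 0 R) :
    U r ≤ d := by
  refine ge_of_tendsto h.U_tendsto ?_
  filter_upwards [Ioo_mem_nhdsGT hr.1] with t ht
  exact h.U_antitone hn ⟨ht.1, ht.2.trans hr.2⟩ hr ht.2.le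

theorem d_pos (h : RadialProfile n σ α K R d U b) (hn : n ≠ 0) (hR : 0 < R) : 0 < d := by
  obtain ⟨r, hr⟩ := nonempty_Ioo.2 hR
  exact (h.U_pos r hr).trans_le (h.U_le hn hr)

theorem b_le (h : RadialProfile n σ α K R d U b) (E : CriticalExponents n σ α)
    (hM : ∀ r ∈ Ioo 0 R, K r ≤ M) (hr : r ∈ Ioo 0 R) : b r ≤ M * d ^ (n * α - 1) / n := by
  have hn := E.natCast_pos
  have hw : r ^ n * b r ≤ r ^ n * (M * d ^ (n * α - 1) / n) := by
    refine le_of_hasDerivAt_le_of_tendsto (f := fun r => r ^ n * b r)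
      (g := fun r => r ^ n * (M * d ^ (n * α - 1) / n)) hr (fun _ ht => h.w_deriv E.ne_zero ht)
      (fun t _ => hasDerivAt_pow_mul_const _ _) (fun t ht _ => ?_)
      h.w_tendsto (tendsto_pow_mul_const_zero E.ne_zero _)
    have := ht.1
    have hK := h.K_pos t ht
    have := h.U_pos t ht
    have hUd := h.U_le E.ne_zero ht
    have := E.one_lt_critical
    rw [mul_div_cancel₀ _ hn.ne']
    gcongr
    · exact hK.le.trans (hM t ht)
    · exact hM t ht
  exact le_of_mul_le_mul_left hw (pow_pos hr.1 n)

theorem le_b (h : RadialProfile n σ α K R d U b) (E : CriticalExponents n σ α)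
    (hA : ∀ r ∈ Ioo 0 R, A ≤ K r) (hr : r ∈ Ioo 0 R) : A * U r ^ (n * α - 1) / n ≤ b r := by
  have hn := E.natCast_pos
  have hw : r ^ n * (A * U r ^ (n * α - 1) / n) ≤ r ^ n * b r := by
    refine le_of_hasDerivAt_le_of_tendsto (g := fun r => r ^ n * b r)
      (f := fun t => t ^ n * (A * U r ^ (n * α - 1) / n)) hr
      (fun t _ => hasDerivAt_pow_mul_const _ _)
      (fun _ ht => h.w_deriv E.ne_zero ht) (fun t ht htr => ?_)
      (tendsto_pow_mul_const_zero E.ne_zero _) h.w_tendsto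
    have := ht.1
    have := h.K_pos t ht
    have := h.U_pos r hr
    have := E.one_lt_critical
    have hAt := hA t ht
    have hUt := h.U_antitone E.ne_zero ht hr htr
    rw [mul_div_cancel₀ _ hn.ne']
    gcongr
  exact le_of_mul_le_mul_left hw (pow_pos hr.1 n)

theorem sub_le_U (h : RadialProfile n σ α K R d U b) (E : CriticalExponents n σ α)
    (hM : ∀ r ∈ Ioo 0 R, K r ≤ M) (hr : r ∈ Ioo 0 R) :
    d - (M * d ^ (n * α - 1) / n) ^ σ * r ^ (σ + 1) ≤ U r := by
  have hσ := E.σ_pos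
  set c := M * d ^ (n * α - 1) / n
  have hc : 0 ≤ c := (h.b_pos E.ne_zero hr).le.trans (h.b_le E hM hr)
  have hle : d - U r ≤ c ^ σ * r ^ (σ + 1) := by
    refine le_of_hasDerivAt_le_of_tendsto (f := fun r => d - U r)
      (g := fun r => c ^ σ * r ^ (σ + 1)) hr (fun t ht => (h.U_deriv t ht).const_sub d)
      (fun t ht => hasDerivAt_const_mul_rpow_add_one _ _ ht.1.ne') (fun t ht _ => ?_)
      (by simpa using h.U_tendsto.const_sub d) (tendsto_const_mul_rpow_zero _ (by linarith))
    have ht0 := ht.1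
    calc - -(t * b t) ^ σ = (t * b t) ^ σ := neg_neg _
      _ ≤ (t * c) ^ σ := by
        have := h.slope_pos E.ne_zero ht
        have := h.b_le E hM ht
        gcongr
      _ = c ^ σ * (1 * t ^ σ) := by rw [Real.mul_rpow ht0.le hc]; ring
      _ ≤ c ^ σ * ((σ + 1) * t ^ σ) := by gcongr; linarith
  linarith

end RadialProfile

/-- The Pohozaev function of a radial profile; it is constant when `K` is. -/
def pohozaev (n : ℕ) (σ α : ℝ) (K U b : ℝ → ℝ) (r : ℝ) : ℝ :=
  r ^ n * ((r * b r) ^ (σ + 1) / (σ + 1) + K r * U r ^ (n * α) / (n * α) - U r * b r / α)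

/-- The constant `c` for which `(1 + c * r ^ (σ + 1)) ^ (-1 / α)`, the bubble of height `1`, solves
the radial equation with `K` constant equal to `A`. -/
def bubbleCoeff (n : ℕ) (σ α A : ℝ) : ℝ := α / (σ + 1) * (A / n) ^ σ

theorem CriticalExponents.bubbleCoeff_pos {n : ℕ} {σ α A : ℝ} (E : CriticalExponents n σ α)
    (hA : 0 < A) : 0 < bubbleCoeff n σ α A := by
  have := E.σ_pos
  have := E.α_pos
  have := E.natCast_pos
  unfold bubbleCoeff
  positivity

namespace RadialProfile

variable {n : ℕ} {σ α : ℝ} {K : ℝ → ℝ} {R d r A M : ℝ} {U b : ℝ → ℝ}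

theorem hasDerivAt_kinetic (h : RadialProfile n σ α K R d U b) (E : CriticalExponents n σ α)
    (hr : r ∈ Ioo 0 R) :
    HasDerivAt (fun t => (t * b t) ^ (σ + 1) / (σ + 1))
      ((b r + (K r * U r ^ (n * α - 1) - n * b r)) * (r * b r) ^ σ) r := by
  have hσ := E.σ_pos
  have hr0 := hr.1.ne'
  refine ((((hasDerivAt_id r).mul (h.b_deriv r hr)).rpow_const (p := σ + 1)
    (Or.inl (h.slope_pos E.ne_zero hr).ne')).div_const (σ + 1)).congr_deriv ?_
  simp only [add_sub_cancel_right, id, Pi.mul_apply]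
  field_simp

theorem hasDerivAt_pohozaev (h : RadialProfile n σ α K R d U b) (E : CriticalExponents n σ α)
    {K' : ℝ} (hr : r ∈ Ioo 0 R) (hK' : HasDerivAt K K' r) :
    HasDerivAt (pohozaev n σ α K U b) (r ^ n * K' * U r ^ (n * α) / (n * α)) r := by
  have hσ := E.σ_pos
  have hα := E.α_pos
  have hn := E.natCast_pos
  have hr0 := hr.1.ne'
  have hU := h.U_pos r hr
  have hslope : (r * b r) ^ (σ + 1) = r * b r * (r * b r) ^ σ := by
    rw [Real.rpow_add_one (h.slope_pos E.ne_zero hr).ne', mul_comm]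
  have hpot : U r ^ (n * α) = U r * U r ^ (n * α - 1) := by
    rw [Real.rpow_sub_one hU.ne']; field_simp
  refine ((hasDerivAt_pow n r).mul (((h.hasDerivAt_kinetic E hr).add
    ((hK'.mul ((h.U_deriv r hr).rpow_const (p := n * α) (Or.inl hU.ne'))).div_const
    (n * α))).sub (((h.U_deriv r hr).mul (h.b_deriv r hr)).div_const α))).congr_deriv ?_
  simp only [Pi.add_apply, Pi.sub_apply, Pi.mul_apply]
  rw [hslope, hpot, ← pow_sub_one_mul E.ne_zero]
  generalize (r * b r) ^ σ = s
  generalize U r ^ (n * α - 1) = v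
  field_simp
  linear_combination (n * r * b r * s) * E.rel

theorem tendsto_pohozaev (h : RadialProfile n σ α K R d U b) (E : CriticalExponents n σ α)
    (hR : 0 < R) (hM : ∀ r ∈ Ioo 0 R, K r ≤ M) :
    Tendsto (pohozaev n σ α K U b) (𝓝[>] 0) (𝓝 0) := by
  have hσ := E.σ_pos
  have hd := h.d_pos E.ne_zero hR
  have hpow : Tendsto (fun r : ℝ => r ^ n) (𝓝[>] 0) (𝓝 0) := by
    simpa using tendsto_pow_mul_const_zero E.ne_zero 1
  have hslope : Tendsto (fun r => r * b r) (𝓝[>] 0) (𝓝 0) := by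
    refine squeeze_zero' ?_ ?_ (by
      simpa using tendsto_pow_mul_const_zero one_ne_zero (M * d ^ (n * α - 1) / n))
    all_goals filter_upwards [Ioo_mem_nhdsGT hR] with r hr
    · exact (h.slope_pos E.ne_zero hr).le
    · exact mul_le_mul_of_nonneg_left (h.b_le E hM hr) hr.1.le
  have hweight : Tendsto (fun r => r ^ n * K r) (𝓝[>] 0) (𝓝 0) := by
    refine squeeze_zero' ?_ ?_ (tendsto_pow_mul_const_zero E.ne_zero M)
    all_goals filter_upwards [Ioo_mem_nhdsGT hR] with r hr
    · exact mul_nonneg (pow_nonneg hr.1.le n) (h.K_pos r hr).le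
    · exact mul_le_mul_of_nonneg_left (hM r hr) (pow_nonneg hr.1.le n)
  have hkin := (hpow.mul (hslope.rpow_const (p := σ + 1) (Or.inr (by linarith)))).div_const (σ + 1)
  have hpot := (hweight.mul (h.U_tendsto.rpow_const (p := n * α) (Or.inl hd.ne'))).div_const (n * α)
  have hmix := (h.U_tendsto.mul h.w_tendsto).div_const α
  have hsum := (hkin.add hpot).sub hmix
  simp only [zero_mul, mul_zero, zero_div, add_zero, sub_zero] at hsum
  refine hsum.congr fun r => ?_
  simp only [pohozaev]
  ring

theorem pohozaev_deriv_nonneg (h : RadialProfile n σ α K R d U b)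
    (E : CriticalExponents n σ α) (W : MonotoneWeight K R A M) (hr : r ∈ Ioo 0 R) :
    0 ≤ r ^ n * deriv K r * U r ^ (n * α) / (n * α) := by
  have := W.deriv_nonneg r hr
  have := h.U_pos r hr
  have := hr.1
  have := E.critical_pos
  positivity

theorem monotoneOn_pohozaev (h : RadialProfile n σ α K R d U b) (E : CriticalExponents n σ α)
    (W : MonotoneWeight K R A M) : MonotoneOn (pohozaev n σ α K U b) (Ioo 0 R) :=
  monotoneOn_Ioo_of_hasDerivAt_nonneg
    (fun t ht => h.hasDerivAt_pohozaev E ht (W.differentiableAt t ht).hasDerivAt)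
    (fun _ ht => h.pohozaev_deriv_nonneg E W ht)

theorem pohozaev_nonneg (h : RadialProfile n σ α K R d U b) (E : CriticalExponents n σ α)
    (W : MonotoneWeight K R A M) (hr : r ∈ Ioo 0 R) : 0 ≤ pohozaev n σ α K U b r := by
  refine le_of_tendsto (h.tendsto_pohozaev E (hr.1.trans hr.2) W.upper) ?_
  filter_upwards [Ioo_mem_nhdsGT hr.1] with t ht
  exact h.monotoneOn_pohozaev E W ⟨ht.1, ht.2.trans hr.2⟩ hr ht.2.le

theorem hasDerivAt_b_mul_U_rpow (h : RadialProfile n σ α K R d U b)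
    (E : CriticalExponents n σ α) (hr : r ∈ Ioo 0 R) :
    HasDerivAt (fun t => b t * U t ^ (-(n * α / (σ + 1))))
      (n * α * pohozaev n σ α K U b r * U r ^ (-(n * α / (σ + 1)) - 1) / (r ^ n * r)) r := by
  have hσ := E.σ_pos
  have hα := E.α_pos
  have hn := E.natCast_pos
  have hr0 := hr.1.ne'
  have hU := h.U_pos r hr
  refine ((h.b_deriv r hr).mul ((h.U_deriv r hr).rpow_const (p := -(n * α / (σ + 1)))
    (Or.inl hU.ne'))).congr_deriv ?_
  have hslope : (r * b r) ^ (σ + 1) = r * b r * (r * b r) ^ σ := by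
    rw [Real.rpow_add_one (h.slope_pos E.ne_zero hr).ne', mul_comm]
  have hU_mul : ∀ s : ℝ, U r ^ s = U r * U r ^ (s - 1) := fun s => by
    rw [Real.rpow_sub_one hU.ne']; field_simp
  rw [pohozaev, hslope, hU_mul (n * α), hU_mul (-(n * α / (σ + 1)))]
  generalize (r * b r) ^ σ = s
  generalize U r ^ (n * α - 1) = v
  generalize U r ^ (-(n * α / (σ + 1)) - 1) = z
  field_simp
  ring

theorem le_b_mul_U_rpow (h : RadialProfile n σ α K R d U b) (E : CriticalExponents n σ α)
    (W : MonotoneWeight K R A M) (hr : r ∈ Ioo 0 R) :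
    A / n * d ^ α ≤ b r * U r ^ (-(n * α / (σ + 1))) := by
  have hd := h.d_pos E.ne_zero (hr.1.trans hr.2)
  have hmono : MonotoneOn (fun t => b t * U t ^ (-(n * α / (σ + 1)))) (Ioo 0 R) := by
    refine monotoneOn_Ioo_of_hasDerivAt_nonneg (fun _ ht => h.hasDerivAt_b_mul_U_rpow E ht)
      fun t ht => ?_
    have := h.pohozaev_nonneg E W ht
    have := h.U_pos t ht
    have := ht.1
    have := E.critical_pos
    positivity
  refine le_of_tendsto ((h.U_tendsto.rpow_const (p := α) (Or.inl hd.ne')).const_mul (A / n)) ?_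
  filter_upwards [Ioo_mem_nhdsGT hr.1] with t ht
  have ht' : t ∈ Ioo 0 R := ⟨ht.1, ht.2.trans hr.2⟩
  have hU := h.U_pos t ht'
  have hexp : α = (n * α - 1) + -(n * α / (σ + 1)) := by
    have hσ := E.σ_pos
    field_simp
    linear_combination E.rel
  calc A / n * U t ^ α = A * U t ^ (n * α - 1) / n * U t ^ (-(n * α / (σ + 1))) := by
        nth_rw 1 [hexp]
        rw [Real.rpow_add hU]
        ring
    _ ≤ b t * U t ^ (-(n * α / (σ + 1))) := by gcongr; exact h.le_b E W.lower ht'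
    _ ≤ b r * U r ^ (-(n * α / (σ + 1))) := hmono ht' hr ht.2.le

theorem mul_rpow_le_slope_rpow (h : RadialProfile n σ α K R d U b)
    (E : CriticalExponents n σ α) (W : MonotoneWeight K R A M) (hr : r ∈ Ioo 0 R) :
    (A / n) ^ σ * d ^ (α * σ) * r ^ σ * U r ^ (α + 1) ≤ (r * b r) ^ σ := by
  have hσ := E.σ_pos
  have hn := E.natCast_pos
  have hA := W.A_pos
  have hU := h.U_pos r hr
  have hr0 := hr.1
  have hd := h.d_pos E.ne_zero (hr0.trans hr.2)
  have hb : A / n * d ^ α * U r ^ (n * α / (σ + 1)) ≤ b r := by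
    have hquot := h.le_b_mul_U_rpow E W hr
    rwa [Real.rpow_neg hU.le, ← div_eq_mul_inv, le_div_iff₀ (by positivity)] at hquot
  have hexp : α + 1 = n * α / (σ + 1) * σ := by
    field_simp
    linear_combination E.rel
  calc (A / n) ^ σ * d ^ (α * σ) * r ^ σ * U r ^ (α + 1)
      = (r * (A / n * d ^ α * U r ^ (n * α / (σ + 1)))) ^ σ := by
        rw [hexp, Real.rpow_mul hU.le, Real.mul_rpow hr0.le (by positivity),
          Real.mul_rpow (x := A / n * d ^ α) (by positivity) (by positivity),
          Real.mul_rpow (by positivity) (by positivity), ← Real.rpow_mul hd.le]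
        ring
    _ ≤ (r * b r) ^ σ := by gcongr

/-- The left-hand side is the explicit bubble solving the equation with `K` constant equal to
`A`, raised to the power `-α`. -/
theorem bubble_le_U_rpow_neg (h : RadialProfile n σ α K R d U b)
    (E : CriticalExponents n σ α) (W : MonotoneWeight K R A M) (hr : r ∈ Ioo 0 R) :
    d ^ (-α) + bubbleCoeff n σ α A * d ^ (α * σ) * r ^ (σ + 1) ≤ U r ^ (-α) := by
  have hσ := E.σ_pos
  have hα := E.α_pos
  have hd := h.d_pos E.ne_zero (hr.1.trans hr.2)
  refine le_of_hasDerivAt_le_of_tendsto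
    (f := fun r => d ^ (-α) + bubbleCoeff n σ α A * d ^ (α * σ) * r ^ (σ + 1))
    (g := fun r => U r ^ (-α)) hr
    (fun t ht => (hasDerivAt_const_mul_rpow_add_one _ _ ht.1.ne').const_add _)
    (fun t ht => (h.U_deriv t ht).rpow_const (Or.inl (h.U_pos t ht).ne')) (fun t ht _ => ?_)
    (by simpa using (tendsto_const_mul_rpow_zero _ (by linarith : 0 < σ + 1)).const_add _)
    (h.U_tendsto.rpow_const (Or.inl hd.ne'))
  have hU := h.U_pos t ht
  have hcancel : U t ^ (α + 1) * U t ^ (-α - 1) = 1 := by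
    rw [← Real.rpow_add hU]; simp
  calc bubbleCoeff n σ α A * d ^ (α * σ) * ((σ + 1) * t ^ σ)
      = (A / n) ^ σ * d ^ (α * σ) * t ^ σ * U t ^ (α + 1) * (α * U t ^ (-α - 1)) := by
        rw [bubbleCoeff]
        field_simp
        linear_combination -((A / n) ^ σ * t ^ σ) * hcancel
    _ ≤ (t * b t) ^ σ * (α * U t ^ (-α - 1)) := by
        gcongr; exact h.mul_rpow_le_slope_rpow E W ht
    _ = -(t * b t) ^ σ * -α * U t ^ (-α - 1) := by ring

end RadialProfile

/-! ### Size of the Pohozaev function in terms of the height -/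

theorem exists_pos_const_mul_rpow_le_one (c : ℝ) {s : ℝ} (hs : 0 < s) :
    ∃ κ : ℝ, 0 < κ ∧ c * κ ^ s ≤ 1 :=
  (eventually_mem_nhdsWithin.and
    ((tendsto_const_mul_rpow_zero c hs).eventually_le_const zero_lt_one)).exists

theorem hasDerivAt_ratio_rpow {k m c t : ℝ} (s : ℝ) (ht : 0 < t) (hm : 0 < m) (hc : 0 < c) :
    HasDerivAt (fun t : ℝ => (t ^ k / (m + c * t ^ k)) ^ s)
      (s * k * m * t ^ (k * s - 1) * (m + c * t ^ k) ^ (-(s + 1))) t := by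
  have hk : 0 < t ^ k := Real.rpow_pos_of_pos ht k
  have hD : 0 < m + c * t ^ k := by positivity
  have hpow := Real.hasDerivAt_rpow_const (x := t) (p := k) (Or.inl ht.ne')
  refine ((hpow.div ((hpow.const_mul c).const_add m) hD.ne').rpow_const (p := s)
    (Or.inl (div_pos hk hD).ne')).congr_deriv ?_
  have hexp : t ^ (k * s - 1) = (t ^ k) ^ (s - 1) * t ^ (k - 1) := by
    rw [← Real.rpow_mul ht.le, ← Real.rpow_add ht]
    ring_nf
  simp only [Pi.div_apply]
  rw [hexp, Real.div_rpow hk.le hD.le, Real.rpow_neg hD.le, Real.rpow_add_one hD.ne',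
    Real.rpow_sub_one hD.ne']
  generalize t ^ (k - 1) = y at *
  generalize (t ^ k) ^ (s - 1) = z at *
  generalize t ^ k = x at *
  field_simp
  ring

theorem ratio_le_inv {x m c : ℝ} (hx : 0 ≤ x) (hm : 0 < m) (hc : 0 < c) :
    x / (m + c * x) ≤ c⁻¹ := by
  rw [div_le_iff₀ (by positivity), mul_add, inv_mul_cancel_left₀ hc.ne']
  have : 0 < c⁻¹ * m := by positivity
  linarith

theorem tendsto_ratio_rpow_zero {k m s : ℝ} (c : ℝ) (hk : 0 < k) (hm : m ≠ 0) (hs : 0 < s) :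
    Tendsto (fun t : ℝ => (t ^ k / (m + c * t ^ k)) ^ s) (𝓝[>] 0) (𝓝 0) := by
  have hnum : Tendsto (fun t : ℝ => t ^ k) (𝓝[>] 0) (𝓝 0) := by
    simpa using tendsto_const_mul_rpow_zero 1 hk
  have hden : Tendsto (fun t : ℝ => m + c * t ^ k) (𝓝[>] 0) (𝓝 m) := by
    simpa using (tendsto_const_mul_rpow_zero c hk).const_add m
  simpa [Real.zero_rpow hs.ne'] using (hnum.div hden hm).rpow_const (p := s) (Or.inr hs.le)

theorem CriticalExponents.pow_mul_slope_rpow {n : ℕ} {σ α b r : ℝ}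
    (E : CriticalExponents n σ α) (hr : 0 < r) (hb : 0 ≤ b) :
    r ^ n * (r * b) ^ (σ + 1) = r ^ (-((σ + 1) / α)) * (r ^ n * b) ^ (σ + 1) := by
  have hexp : (n : ℝ) + (σ + 1) = -((σ + 1) / α) + n * (σ + 1) := by
    linear_combination E.natCast_add_threshold
  rw [Real.mul_rpow hr.le hb, Real.mul_rpow (by positivity) hb, ← mul_assoc, ← mul_assoc,
    ← Real.rpow_natCast, ← Real.rpow_mul hr.le, ← Real.rpow_add hr, ← Real.rpow_add hr, hexp]

namespace RadialProfile

variable {n : ℕ} {σ α : ℝ} {K : ℝ → ℝ} {R d r A M c C κ ℓ : ℝ} {U b : ℝ → ℝ}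

theorem half_le_U (h : RadialProfile n σ α K R d U b) (E : CriticalExponents n σ α)
    (hM : ∀ r ∈ Ioo 0 R, K r ≤ M) (hκ : 0 < κ) (hκM : 2 * (M / n) ^ σ * κ ^ (σ + 1) ≤ 1)
    (hr : r ∈ Ioo 0 R) (hle : r ≤ κ * d ^ (-α)) : d / 2 ≤ U r := by
  have hσ := E.σ_pos
  have hn := E.natCast_pos
  have hM0 : 0 < M := (h.K_pos r hr).trans_le (hM r hr)
  have hr0 := hr.1
  have hd := h.d_pos E.ne_zero (hr0.trans hr.2)
  have hexp : d ^ ((n * α - 1) * σ) * d ^ (-α * (σ + 1)) = d := by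
    rw [← Real.rpow_add hd]
    convert Real.rpow_one d using 2
    linear_combination -E.rel
  have hdrop : (M * d ^ (n * α - 1) / n) ^ σ * r ^ (σ + 1) ≤ d / 2 := by
    calc (M * d ^ (n * α - 1) / n) ^ σ * r ^ (σ + 1)
        ≤ (M / n * d ^ (n * α - 1)) ^ σ * (κ * d ^ (-α)) ^ (σ + 1) := by
          rw [mul_div_right_comm]
          gcongr
      _ = (M / n) ^ σ * κ ^ (σ + 1) * (d ^ ((n * α - 1) * σ) * d ^ (-α * (σ + 1))) := by
          rw [Real.mul_rpow (by positivity) (by positivity),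
            Real.mul_rpow (by positivity) (by positivity), Real.rpow_mul hd.le,
            Real.rpow_mul hd.le]
          ring
      _ ≤ d / 2 := by rw [hexp]; nlinarith
  linarith [h.sub_le_U E hM hr]

theorem le_w_of_core_le (h : RadialProfile n σ α K R d U b) (E : CriticalExponents n σ α)
    (W : MonotoneWeight K R A M) (hκ : 0 < κ) (hcore : d / 2 ≤ U (κ * d ^ (-α)))
    (hr : r ∈ Ioo 0 R) (hle : κ * d ^ (-α) ≤ r) :
    κ ^ n * A / n * (1 / 2) ^ (n * α - 1) / d ≤ r ^ n * b r := by
  have hd := h.d_pos E.ne_zero (hr.1.trans hr.2)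
  have hA := W.A_pos
  have hn := E.natCast_pos
  have hq := E.one_lt_critical
  have hcore0 : 0 < κ * d ^ (-α) := by positivity
  have hcoreR : κ * d ^ (-α) ∈ Ioo 0 R := ⟨hcore0, hle.trans_lt hr.2⟩
  have hexp : d⁻¹ = d ^ (-α * n) * d ^ (n * α - 1) := by
    rw [← Real.rpow_add hd, ← Real.rpow_neg_one]
    ring_nf
  calc κ ^ n * A / n * (1 / 2) ^ (n * α - 1) / d
      = (κ * d ^ (-α)) ^ n * (A * (d / 2) ^ (n * α - 1) / n) := by
        rw [mul_pow, ← Real.rpow_natCast (d ^ _), ← Real.rpow_mul hd.le, div_eq_mul_one_div d 2,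
          Real.mul_rpow hd.le (by norm_num), div_eq_mul_inv _ d, hexp]
        ring
    _ ≤ (κ * d ^ (-α)) ^ n * (A * U (κ * d ^ (-α)) ^ (n * α - 1) / n) := by gcongr
    _ ≤ (κ * d ^ (-α)) ^ n * b (κ * d ^ (-α)) := by gcongr; exact h.le_b E W.lower hcoreR
    _ ≤ r ^ n * b r := h.w_mono E.ne_zero hcoreR hr hle

theorem rpow_le_pohozaev (h : RadialProfile n σ α K R d U b) (E : CriticalExponents n σ α)
    (W : MonotoneWeight K R A M) (hℓ : 0 < ℓ) {δ : ℝ} (hδ : 0 ≤ δ)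
    (hKc : ∀ t ∈ Ioo 0 R, c * t ^ (ℓ - 1) ≤ deriv K t) (hr : r ∈ Ioo 0 R)
    (hU : ∀ t ∈ Ioo 0 R, t ≤ r → δ ≤ U t) :
    c * δ ^ (n * α) / (n * α * (n + ℓ)) * r ^ (n + ℓ) ≤ pohozaev n σ α K U b r := by
  have hn := E.natCast_pos
  have hq := E.critical_pos
  refine le_of_hasDerivAt_le_of_tendsto
    (f := fun r => c * δ ^ (n * α) / (n * α * (n + ℓ)) * r ^ (n + ℓ)) hr
    (fun t ht => (Real.hasDerivAt_rpow_const (Or.inl ht.1.ne')).const_mul _)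
    (fun t ht => h.hasDerivAt_pohozaev E ht (W.differentiableAt t ht).hasDerivAt)
    (fun t ht htr => ?_) (tendsto_const_mul_rpow_zero _ (by linarith))
    (h.tendsto_pohozaev E (hr.1.trans hr.2) W.upper)
  have ht0 := ht.1
  have hexp : t ^ (n + ℓ - 1) = t ^ n * t ^ (ℓ - 1) := by
    rw [← Real.rpow_natCast, ← Real.rpow_add ht0]
    ring_nf
  calc c * δ ^ (n * α) / (n * α * (n + ℓ)) * ((n + ℓ) * t ^ (n + ℓ - 1))
      = t ^ n * (c * t ^ (ℓ - 1)) * δ ^ (n * α) / (n * α) := by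
        rw [hexp]
        field_simp
    _ ≤ t ^ n * deriv K t * U t ^ (n * α) / (n * α) := by
        have := W.deriv_nonneg t ht
        have := hU t ht htr
        have := hKc t ht
        gcongr

theorem core_le_pohozaev (h : RadialProfile n σ α K R d U b) (E : CriticalExponents n σ α)
    (W : MonotoneWeight K R A M) (hκ : 0 < κ) (hκM : 2 * (M / n) ^ σ * κ ^ (σ + 1) ≤ 1)
    (hℓ : 0 < ℓ) (hKc : ∀ t ∈ Ioo 0 R, c * t ^ (ℓ - 1) ≤ deriv K t)
    (hcore : κ * d ^ (-α) ∈ Ioo 0 R) :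
    c * (1 / 2) ^ (n * α) * κ ^ (n + ℓ) / (n * α * (n + ℓ)) * d ^ (-(α * ℓ)) ≤
      pohozaev n σ α K U b (κ * d ^ (-α)) := by
  have hd := h.d_pos E.ne_zero (hcore.1.trans hcore.2)
  refine le_of_eq_of_le ?_ (h.rpow_le_pohozaev E W hℓ (half_pos hd).le hKc hcore
    fun t ht => h.half_le_U E W.upper hκ hκM ht)
  have hexp : d ^ (-(α * ℓ)) = d ^ (n * α) * d ^ (-α * (n + ℓ)) := by
    rw [← Real.rpow_add hd]
    ring_nf
  rw [Real.mul_rpow hκ.le (by positivity), ← Real.rpow_mul hd.le, div_eq_mul_one_div d 2,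
    Real.mul_rpow hd.le (by norm_num), hexp]
  ring

theorem U_rpow_le_bubble (h : RadialProfile n σ α K R d U b) (E : CriticalExponents n σ α)
    (W : MonotoneWeight K R A M) (hr : r ∈ Ioo 0 R) :
    U r ^ (n * α) ≤
      (d ^ (-α) + bubbleCoeff n σ α A * d ^ (α * σ) * r ^ (σ + 1)) ^ (-(n : ℝ)) := by
  have hU := h.U_pos r hr
  have hr0 := hr.1
  have hd := h.d_pos E.ne_zero (hr0.trans hr.2)
  have hcoeff := E.bubbleCoeff_pos W.A_pos
  calc U r ^ (n * α) = (U r ^ (-α)) ^ (-(n : ℝ)) := by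
        rw [← Real.rpow_mul hU.le]
        ring_nf
    _ ≤ _ := Real.rpow_le_rpow_of_nonpos (by positivity) (h.bubble_le_U_rpow_neg E W hr)
        (by linarith [E.natCast_pos])

/-- For `K' ≤ C r^{ℓ* - 1}` the derivative of the Pohozaev function is dominated, through the bubble
bound, by an exact derivative. -/
theorem pohozaev_le_ratio_rpow (h : RadialProfile n σ α K R d U b) (E : CriticalExponents n σ α)
    (W : MonotoneWeight K R A M) (hKC : ∀ r ∈ Ioo 0 R, deriv K r ≤ C * r ^ ((σ + 1) / α - 1))
    (hr : r ∈ Ioo 0 R) :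
    pohozaev n σ α K U b r ≤ C / (n * α * (n - 1) * (σ + 1) * d ^ (-α)) *
      (r ^ (σ + 1) / (d ^ (-α) + bubbleCoeff n σ α A * d ^ (α * σ) * r ^ (σ + 1))) ^
        ((n : ℝ) - 1) := by
  have hσ := E.σ_pos
  have hq := E.critical_pos
  have hn : 0 < (n : ℝ) - 1 := sub_pos.2 E.one_lt_natCast
  have hd := h.d_pos E.ne_zero (hr.1.trans hr.2)
  have hm : 0 < d ^ (-α) := by positivity
  have hk : 0 < bubbleCoeff n σ α A * d ^ (α * σ) :=
    mul_pos (E.bubbleCoeff_pos W.A_pos) (by positivity)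
  refine le_of_hasDerivAt_le_of_tendsto hr
    (fun t ht => h.hasDerivAt_pohozaev E ht (W.differentiableAt t ht).hasDerivAt)
    (fun t ht => (hasDerivAt_ratio_rpow _ ht.1 hm hk).const_mul _) (fun t ht _ => ?_)
    (h.tendsto_pohozaev E (hr.1.trans hr.2) W.upper)
    (by simpa using (tendsto_ratio_rpow_zero _ (by linarith) hm.ne' hn).const_mul _)
  have ht0 := ht.1
  have hU := h.U_pos t ht
  have hK' := W.deriv_nonneg t ht
  have hexp : t ^ ((σ + 1) * ((n : ℝ) - 1) - 1) = t ^ n * t ^ ((σ + 1) / α - 1) := by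
    rw [← E.natCast_add_threshold, ← Real.rpow_natCast, ← Real.rpow_add ht0]
    ring_nf
  set D := d ^ (-α) + bubbleCoeff n σ α A * d ^ (α * σ) * t ^ (σ + 1)
  calc t ^ n * deriv K t * U t ^ (n * α) / (n * α)
      ≤ t ^ n * (C * t ^ ((σ + 1) / α - 1)) * D ^ (-(n : ℝ)) / (n * α) := by
        gcongr
        · exact mul_nonneg (by positivity) (hK'.trans (hKC t ht))
        · exact hKC t ht
        · exact h.U_rpow_le_bubble E W ht
    _ = _ := by
        rw [hexp, sub_add_cancel]
        field_simp

theorem pohozaev_le (h : RadialProfile n σ α K R d U b) (E : CriticalExponents n σ α)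
    (W : MonotoneWeight K R A M) (hC : 0 ≤ C)
    (hKC : ∀ r ∈ Ioo 0 R, deriv K r ≤ C * r ^ ((σ + 1) / α - 1)) (hr : r ∈ Ioo 0 R) :
    pohozaev n σ α K U b r ≤ C / (n * α * (n - 1) * (σ + 1)) *
      (bubbleCoeff n σ α A)⁻¹ ^ ((n : ℝ) - 1) * d ^ (-(σ + 1)) := by
  have hσ := E.σ_pos
  have hq := E.critical_pos
  have hn : 0 < (n : ℝ) - 1 := sub_pos.2 E.one_lt_natCast
  have hd := h.d_pos E.ne_zero (hr.1.trans hr.2)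
  have hr0 := hr.1
  have hcoeff := E.bubbleCoeff_pos W.A_pos
  have hexp : d ^ (-(σ + 1)) = d ^ α * d ^ (-(α * σ) * ((n : ℝ) - 1)) := by
    rw [← Real.rpow_add hd]
    congr 1
    linear_combination -E.rel
  refine (h.pohozaev_le_ratio_rpow E W hKC hr).trans ?_
  calc C / (n * α * (n - 1) * (σ + 1) * d ^ (-α)) *
        (r ^ (σ + 1) / (d ^ (-α) + bubbleCoeff n σ α A * d ^ (α * σ) * r ^ (σ + 1))) ^
          ((n : ℝ) - 1)
      ≤ C / (n * α * (n - 1) * (σ + 1) * d ^ (-α)) *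
        (bubbleCoeff n σ α A * d ^ (α * σ))⁻¹ ^ ((n : ℝ) - 1) := by
        gcongr
        exact ratio_le_inv (by positivity) (by positivity) (by positivity)
    _ = _ := by
        rw [mul_inv, ← Real.rpow_neg hd.le, Real.mul_rpow (by positivity) (by positivity),
          ← Real.rpow_mul hd.le, hexp, Real.rpow_neg hd.le]
        field_simp

theorem core_lt_of_tendsto_zero (h : RadialProfile n σ α K R d U b)
    (E : CriticalExponents n σ α) (hM : ∀ r ∈ Ioo 0 R, K r ≤ M) (hκ : 0 < κ)
    (hκM : 2 * (M / n) ^ σ * κ ^ (σ + 1) ≤ 1) (hR : 0 < R) (hU : Tendsto U (𝓝[<] R) (𝓝 0)) :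
    κ * d ^ (-α) < R := by
  by_contra! hle
  have : d / 2 ≤ 0 := by
    refine ge_of_tendsto hU ?_
    filter_upwards [Ioo_mem_nhdsLT hR] with r hr
    exact h.half_le_U E hM hκ hκM hr (hr.2.le.trans hle)
  linarith [h.d_pos E.ne_zero hR]

theorem kinetic_le (h : RadialProfile n σ α K R d U b) (E : CriticalExponents n σ α)
    (hr : r ∈ Ioo 0 R) :
    r ^ n * (r * b r) ^ (σ + 1) / (σ + 1) ≤ pohozaev n σ α K U b r + U r * (r ^ n * b r) / α := by
  have := h.K_pos r hr
  have := h.U_pos r hr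
  have := E.critical_pos
  have hr0 := hr.1
  have hpot : 0 ≤ r ^ n * (K r * U r ^ (n * α) / (n * α)) := by positivity
  unfold pohozaev
  linear_combination hpot

/-- At a zero of `U` only the kinetic part of the Pohozaev function survives. -/
theorem rpow_mul_flux_le_of_tendsto_zero (h : RadialProfile n σ α K R d U b)
    (E : CriticalExponents n σ α) (hM : ∀ r ∈ Ioo 0 R, K r ≤ M) {r₀ w P : ℝ}
    (hr₀ : r₀ ∈ Ioo 0 R) (hw : 0 ≤ w) (hwb : ∀ r ∈ Ioo r₀ R, w ≤ r ^ n * b r)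
    (hP : ∀ r ∈ Ioo r₀ R, pohozaev n σ α K U b r ≤ P) (hU : Tendsto U (𝓝[<] R) (𝓝 0)) :
    R ^ (-((σ + 1) / α)) * w ^ (σ + 1) / (σ + 1) ≤ P := by
  have hσ := E.σ_pos
  have hα := E.α_pos
  have hlim : Tendsto (fun r => P + U r * (R ^ n * (M * d ^ (n * α - 1) / n)) / α) (𝓝[<] R)
      (𝓝 P) := by
    simpa using ((hU.mul_const (R ^ n * (M * d ^ (n * α - 1) / n))).div_const α).const_add P
  refine ge_of_tendsto hlim ?_
  filter_upwards [Ioo_mem_nhdsLT hr₀.2] with r hr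
  have hr' : r ∈ Ioo 0 R := ⟨hr₀.1.trans hr.1, hr.2⟩
  have hr0 := hr'.1
  have hb := h.b_pos E.ne_zero hr'
  have hbM := h.b_le E hM hr'
  have hUr := h.U_pos r hr'
  have hR := hr'.1.trans hr'.2
  calc R ^ (-((σ + 1) / α)) * w ^ (σ + 1) / (σ + 1)
      ≤ r ^ (-((σ + 1) / α)) * (r ^ n * b r) ^ (σ + 1) / (σ + 1) := by
        have := Real.rpow_le_rpow_of_nonpos hr0 hr.2.le
          (by rw [neg_nonpos]; positivity : -((σ + 1) / α) ≤ 0)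
        have := hwb r hr
        gcongr
    _ = r ^ n * (r * b r) ^ (σ + 1) / (σ + 1) := by rw [E.pow_mul_slope_rpow hr0 hb.le]
    _ ≤ pohozaev n σ α K U b r + U r * (r ^ n * b r) / α := h.kinetic_le E hr'
    _ ≤ P + U r * (R ^ n * (M * d ^ (n * α - 1) / n)) / α := by
        have := hP r hr
        have := hr.2.le
        gcongr

theorem rpow_neg_radius_le_of_tendsto_zero (h : RadialProfile n σ α K R d U b)
    (E : CriticalExponents n σ α) (W : MonotoneWeight K R A M) (hR : 0 < R) (hC : 0 ≤ C)
    (hKC : ∀ r ∈ Ioo 0 R, deriv K r ≤ C * r ^ ((σ + 1) / α - 1)) (hκ : 0 < κ)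
    (hκM : 2 * (M / n) ^ σ * κ ^ (σ + 1) ≤ 1) (hU : Tendsto U (𝓝[<] R) (𝓝 0)) :
    R ^ (-((σ + 1) / α)) ≤ C / (n * α * (n - 1)) * (bubbleCoeff n σ α A)⁻¹ ^ ((n : ℝ) - 1) /
      (κ ^ n * A / n * (1 / 2) ^ (n * α - 1)) ^ (σ + 1) := by
  have hσ := E.σ_pos
  have hn := E.natCast_pos
  have hA := W.A_pos
  have hd := h.d_pos E.ne_zero hR
  have hcore : κ * d ^ (-α) ∈ Ioo 0 R :=
    ⟨by positivity, h.core_lt_of_tendsto_zero E W.upper hκ hκM hR hU⟩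
  have hcoreU := h.half_le_U E W.upper hκ hκM hcore le_rfl
  have hflux := h.rpow_mul_flux_le_of_tendsto_zero E W.upper hcore (by positivity)
    (fun r hr => h.le_w_of_core_le E W hκ hcoreU ⟨hcore.1.trans hr.1, hr.2⟩ hr.1.le)
    (fun r hr => h.pohozaev_le E W hC hKC ⟨hcore.1.trans hr.1, hr.2⟩) hU
  set w := κ ^ n * A / n * (1 / 2) ^ (n * α - 1)
  have hw : 0 < w ^ (σ + 1) := by positivity
  have hdσ : 0 < d ^ (σ + 1) := by positivity
  rw [Real.div_rpow (by positivity) hd.le, Real.rpow_neg hd.le, ← div_eq_mul_inv, ← mul_div_assoc,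
    div_div, mul_comm (d ^ (σ + 1)), ← div_div, div_le_div_iff_of_pos_right hdσ,
    div_le_iff₀ (by linarith)] at hflux
  rw [le_div_iff₀ hw]
  refine hflux.trans_eq ?_
  field_simp

theorem exists_radius_le_of_tendsto_zero (E : CriticalExponents n σ α) (hA : 0 < A) (hC : 0 < C)
    (M : ℝ) :
    ∃ R₀ : ℝ, 0 < R₀ ∧ ∀ {K : ℝ → ℝ} {R d : ℝ} {U b : ℝ → ℝ}, RadialProfile n σ α K R d U b →
      0 < R → MonotoneWeight K R A M →
      (∀ r ∈ Ioo 0 R, deriv K r ≤ C * r ^ ((σ + 1) / α - 1)) →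
      Tendsto U (𝓝[<] R) (𝓝 0) → R₀ ≤ R := by
  have hσ := E.σ_pos
  have hα := E.α_pos
  have hn := E.natCast_pos
  have hn1 : 0 < (n : ℝ) - 1 := sub_pos.2 E.one_lt_natCast
  have hcoeff := E.bubbleCoeff_pos hA
  obtain ⟨κ, hκ, hκM⟩ :=
    exists_pos_const_mul_rpow_le_one (2 * (M / n) ^ σ) (by linarith : 0 < σ + 1)
  set L := C / (n * α * (n - 1)) * (bubbleCoeff n σ α A)⁻¹ ^ ((n : ℝ) - 1) /
    (κ ^ n * A / n * (1 / 2) ^ (n * α - 1)) ^ (σ + 1)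
  have hL : 0 < L := by positivity
  refine ⟨L ^ (-((σ + 1) / α))⁻¹, by positivity, fun h hR W hKC hU => ?_⟩
  rw [Real.rpow_inv_le_iff_of_neg hL hR (by rw [neg_lt_zero]; positivity)]
  exact h.rpow_neg_radius_le_of_tendsto_zero E W hR hC.le hKC hκ hκM hU

theorem U_le_mul_rpow_neg (h : RadialProfile n σ α K R d U b) (E : CriticalExponents n σ α)
    (W : MonotoneWeight K R A M) (hr : r ∈ Ioo 0 R) :
    U r ≤ (bubbleCoeff n σ α A * r ^ (σ + 1)) ^ (-(1 / α)) * d ^ (-σ) := by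
  have hα := E.α_pos
  have hr0 := hr.1
  have hd := h.d_pos E.ne_zero (hr0.trans hr.2)
  have hU := h.U_pos r hr
  have hcoeff := E.bubbleCoeff_pos W.A_pos
  have hdσ : (d ^ (α * σ)) ^ (-(1 / α)) = d ^ (-σ) := by
    rw [← Real.rpow_mul hd.le]
    field_simp
  have hbubble : bubbleCoeff n σ α A * r ^ (σ + 1) * d ^ (α * σ) ≤ U r ^ (-α) := by
    have hdα : 0 < d ^ (-α) := by positivity
    linarith [h.bubble_le_U_rpow_neg E W hr]
  calc U r = (U r ^ (-α)) ^ (-(1 / α)) := by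
        rw [← Real.rpow_mul hU.le, neg_mul_neg, mul_one_div_cancel hα.ne', Real.rpow_one]
    _ ≤ (bubbleCoeff n σ α A * r ^ (σ + 1) * d ^ (α * σ)) ^ (-(1 / α)) :=
        Real.rpow_le_rpow_of_nonpos (by positivity) hbubble (by rw [neg_nonpos]; positivity)
    _ = _ := by rw [Real.mul_rpow (by positivity) (by positivity), hdσ]

theorem exists_slope_rpow_le (h : RadialProfile n σ α K R d U b) {s t : ℝ} (hs : s ∈ Ioo 0 R)
    (ht : t ∈ Ioo 0 R) (hst : s < t) : ∃ r ∈ Ioo s t, (r * b r) ^ σ ≤ U s / (t - s) := by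
  have hmem : ∀ r ∈ Icc s t, r ∈ Ioo 0 R := fun r hr =>
    ⟨hs.1.trans_le hr.1, hr.2.trans_lt ht.2⟩
  obtain ⟨r, hr, hslope⟩ := exists_hasDerivAt_eq_slope U (fun r => -(r * b r) ^ σ) hst
    (fun x hx => (h.U_deriv x (hmem x hx)).continuousAt.continuousWithinAt)
    (fun x hx => h.U_deriv x (hmem x (Ioo_subset_Icc_self hx)))
  refine ⟨r, hr, ?_⟩
  rw [neg_eq_iff_eq_neg.1 hslope, ← neg_div, neg_sub]
  have := h.U_pos t ht
  have : 0 < t - s := sub_pos.2 hst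
  gcongr
  linarith

theorem pohozaev_le_of_le_mul_rpow_neg (h : RadialProfile n σ α K R d U b)
    (E : CriticalExponents n σ α) (hr : r ∈ Ioo 0 R) (hM : K r ≤ M) (hd : 1 ≤ d) {X Y : ℝ}
    (hX : U r ≤ X * d ^ (-σ)) (hY : (r * b r) ^ σ ≤ Y * d ^ (-σ)) :
    pohozaev n σ α K U b r ≤ R ^ n * (Y ^ ((σ + 1) / σ) / (σ + 1) + M * X ^ (n * α) / (n * α)) *
      d ^ (-(σ + 1)) := by
  have hσ := E.σ_pos
  have hα := E.α_pos
  have hq := E.critical_pos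
  have hd0 : 0 < d := by linarith
  have hr0 := hr.1
  have hU := h.U_pos r hr
  have hb := h.b_pos E.ne_zero hr
  have hK := h.K_pos r hr
  have hX0 : 0 < X := pos_of_mul_pos_left (hU.trans_le hX) (by positivity)
  have hY0 : 0 < Y := pos_of_mul_pos_left ((by positivity : 0 < (r * b r) ^ σ).trans_le hY)
    (by positivity)
  have hkin : (r * b r) ^ (σ + 1) ≤ Y ^ ((σ + 1) / σ) * d ^ (-(σ + 1)) := by
    calc (r * b r) ^ (σ + 1) = ((r * b r) ^ σ) ^ ((σ + 1) / σ) := by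
          rw [← Real.rpow_mul (by positivity), mul_div_cancel₀ _ hσ.ne']
      _ ≤ (Y * d ^ (-σ)) ^ ((σ + 1) / σ) := by gcongr
      _ = Y ^ ((σ + 1) / σ) * d ^ (-(σ + 1)) := by
          rw [Real.mul_rpow hY0.le (by positivity), ← Real.rpow_mul hd0.le, neg_mul,
            mul_div_cancel₀ _ hσ.ne']
  have hpot : U r ^ (n * α) ≤ X ^ (n * α) * d ^ (-(σ + 1)) := by
    calc U r ^ (n * α) ≤ (X * d ^ (-σ)) ^ (n * α) := by gcongr
      _ = X ^ (n * α) * d ^ (-σ * (n * α)) := by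
          rw [Real.mul_rpow hX0.le (by positivity), ← Real.rpow_mul hd0.le]
      _ ≤ X ^ (n * α) * d ^ (-(σ + 1)) := by
          gcongr
          nlinarith [E.rel]
  calc pohozaev n σ α K U b r
      ≤ r ^ n * ((r * b r) ^ (σ + 1) / (σ + 1) + K r * U r ^ (n * α) / (n * α)) := by
        unfold pohozaev
        gcongr
        exact sub_le_self _ (by positivity)
    _ ≤ R ^ n * (Y ^ ((σ + 1) / σ) * d ^ (-(σ + 1)) / (σ + 1) +
          M * (X ^ (n * α) * d ^ (-(σ + 1))) / (n * α)) := by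
        have hrR := hr.2.le
        have hR := hr.1.trans hr.2
        have hM0 := hK.le.trans hM
        gcongr
    _ = _ := by ring

theorem exists_const_pohozaev_le (E : CriticalExponents n σ α) (W : MonotoneWeight K R A M)
    (hR : 0 < R) :
    ∃ C, ∀ d U b, 1 ≤ d → RadialProfile n σ α K R d U b →
      ∃ r ∈ Ioo (R / 2) R, pohozaev n σ α K U b r ≤ C * d ^ (-(σ + 1)) := by
  have hs : R / 2 ∈ Ioo 0 R := ⟨by linarith, by linarith⟩
  have ht : 3 * R / 4 ∈ Ioo 0 R := ⟨by linarith, by linarith⟩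
  have hst : R / 2 < 3 * R / 4 := by linarith
  set X := (bubbleCoeff n σ α A * (R / 2) ^ (σ + 1)) ^ (-(1 / α))
  set Y := X / (3 * R / 4 - R / 2)
  refine ⟨R ^ n * (Y ^ ((σ + 1) / σ) / (σ + 1) + M * X ^ (n * α) / (n * α)),
    fun d U b hd h => ?_⟩
  obtain ⟨r, hr, hslope⟩ := h.exists_slope_rpow_le hs ht hst
  have hr' : r ∈ Ioo 0 R := ⟨hs.1.trans hr.1, hr.2.trans ht.2⟩
  have hX := h.U_le_mul_rpow_neg E W hs
  have hY : (r * b r) ^ σ ≤ Y * d ^ (-σ) := by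
    calc (r * b r) ^ σ ≤ U (R / 2) / (3 * R / 4 - R / 2) := hslope
      _ ≤ X * d ^ (-σ) / (3 * R / 4 - R / 2) := div_le_div_of_nonneg_right hX (by linarith)
      _ = Y * d ^ (-σ) := mul_div_right_comm ..
  exact ⟨r, ⟨hr.1, hr'.2⟩, h.pohozaev_le_of_le_mul_rpow_neg E hr' (W.upper r hr') hd
    ((h.U_antitone E.ne_zero hs hr' hr.1.le).trans hX) hY⟩

/-- As `d → ∞` the Pohozaev function is at least of order `d ^ (-α ℓ)` once the core of radius
`d ^ (-α)` is left, but at most of order `d ^ (-(σ + 1))` at some point of `(R / 2, R)`. -/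
theorem eventually_not_radialProfile (E : CriticalExponents n σ α) (W : MonotoneWeight K R A M)
    (hR : 0 < R) (hc : 0 < c) (hℓ : 0 < ℓ) (hℓ' : ℓ < (σ + 1) / α)
    (hKc : ∀ r ∈ Ioo 0 R, c * r ^ (ℓ - 1) ≤ deriv K r) :
    ∀ᶠ d in atTop, ∀ U b : ℝ → ℝ, ¬ RadialProfile n σ α K R d U b := by
  have hσ := E.σ_pos
  have hα := E.α_pos
  have hq := E.critical_pos
  obtain ⟨κ, hκ, hκM⟩ :=
    exists_pos_const_mul_rpow_le_one (2 * (M / n) ^ σ) (by linarith : 0 < σ + 1)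
  obtain ⟨C, hC⟩ := exists_const_pohozaev_le E W hR
  set c₁ := c * (1 / 2) ^ (n * α) * κ ^ (n + ℓ) / (n * α * (n + ℓ))
  have hc₁ : 0 < c₁ := by positivity
  have hgap : 0 < σ + 1 - α * ℓ := by
    rw [lt_div_iff₀ hα] at hℓ'
    linarith
  have hlarge : ∀ᶠ d : ℝ in atTop, C / c₁ < d ^ (σ + 1 - α * ℓ) :=
    (tendsto_rpow_atTop hgap).eventually_gt_atTop _
  have hcore : ∀ᶠ d : ℝ in atTop, κ * d ^ (-α) < R / 2 := by
    have : Tendsto (fun d : ℝ => κ * d ^ (-α)) atTop (𝓝 0) := by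
      simpa using (tendsto_rpow_neg_atTop hα).const_mul κ
    exact this.eventually_lt_const (half_pos hR)
  filter_upwards [hlarge, hcore, eventually_ge_atTop 1] with d hlarge hcore hd U b h
  have hd0 : 0 < d := by linarith
  have hcoreR : κ * d ^ (-α) ∈ Ioo 0 R := ⟨by positivity, by linarith⟩
  obtain ⟨r, hr, hup⟩ := hC d U b hd h
  have hbound : c₁ * d ^ (-(α * ℓ)) ≤ C * d ^ (-(σ + 1)) :=
    (h.core_le_pohozaev E W hκ hκM hℓ hKc hcoreR).trans <|
      (h.monotoneOn_pohozaev E W hcoreR ⟨by linarith [hr.1], hr.2⟩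
        (hcore.trans hr.1).le).trans hup
  rw [div_lt_iff₀ hc₁, Real.rpow_sub hd0, div_mul_eq_mul_div, lt_div_iff₀ (by positivity)]
    at hlarge
  rw [Real.rpow_neg hd0.le, Real.rpow_neg hd0.le, ← div_eq_mul_inv, ← div_eq_mul_inv,
    div_le_div_iff₀ (by positivity) (by positivity)] at hbound
  linarith

end RadialProfile

/-! ### A Volterra equation with a parameter -/

/-- The weighted mean `∫₀¹ τ^m g(rτ) dτ`, i.e. `r^{-(m+1)} ∫₀^r t^m g(t) dt` for `r ≠ 0`: the flux
coefficient in dimension `m + 1` generated by the radial source `g`. -/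
def ballAvg (m : ℕ) (g : ℝ → ℝ) (r : ℝ) : ℝ := ∫ τ in (0 : ℝ)..1, τ ^ m * g (r * τ)

section BallAvg

variable {m : ℕ} {g g₁ g₂ : ℝ → ℝ} {c r : ℝ}

theorem continuous_ballAvg (hg : Continuous g) : Continuous (ballAvg m g) := by
  unfold ballAvg
  apply intervalIntegral.continuous_parametric_intervalIntegral_of_continuous'
  fun_prop

theorem pow_succ_mul_ballAvg (m : ℕ) (g : ℝ → ℝ) (r : ℝ) :
    r ^ (m + 1) * ballAvg m g r = ∫ t in (0 : ℝ)..r, t ^ m * g t := by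
  have hsubst := intervalIntegral.mul_integral_comp_mul_left (a := 0) (b := 1)
    (f := fun t => t ^ m * g t) r
  rw [mul_zero, mul_one] at hsubst
  rw [← hsubst, ballAvg, pow_succ', mul_assoc, ← intervalIntegral.integral_const_mul]
  simp only [mul_pow, mul_assoc]

theorem ballAvg_zero (m : ℕ) (g : ℝ → ℝ) : ballAvg m g 0 = g 0 / (m + 1) := by
  simp [ballAvg, integral_pow, div_eq_inv_mul]

theorem hasDerivAt_ballAvg (hg : Continuous g) (hr : r ≠ 0) :
    HasDerivAt (ballAvg m g) ((g r - (m + 1) * ballAvg m g r) / r) r := by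
  have hint : HasDerivAt (fun r => ∫ t in (0 : ℝ)..r, t ^ m * g t) (r ^ m * g r) r :=
    (Continuous.integral_hasStrictDerivAt (by fun_prop) 0 r).hasDerivAt
  have hpow : HasDerivAt (fun r : ℝ => r ^ (m + 1)) ((m + 1) * r ^ m) r := by
    simpa using hasDerivAt_pow (m + 1) r
  have hquot : ballAvg m g =ᶠ[𝓝 r]
      (fun r => ∫ t in (0 : ℝ)..r, t ^ m * g t) / (fun r : ℝ => r ^ (m + 1)) := by
    filter_upwards [isOpen_ne.mem_nhds hr] with t ht
    rw [Pi.div_apply, ← pow_succ_mul_ballAvg, mul_div_cancel_left₀ _ (pow_ne_zero _ ht)]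
  refine ((hint.div hpow (pow_ne_zero _ hr)).congr_of_eventuallyEq hquot).congr_deriv ?_
  rw [← pow_succ_mul_ballAvg]
  field_simp
  ring

theorem abs_ballAvg_le (hr : 0 ≤ r) (h : ∀ t ∈ Icc 0 r, |g t| ≤ c) : |ballAvg m g r| ≤ c := by
  have hbound : ∀ τ ∈ uIoc (0 : ℝ) 1, ‖τ ^ m * g (r * τ)‖ ≤ c := by
    intro τ hτ
    rw [uIoc_of_le zero_le_one] at hτ
    rw [norm_mul, Real.norm_eq_abs, Real.norm_eq_abs, abs_of_nonneg (pow_nonneg hτ.1.le m)]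
    exact (mul_le_of_le_one_left (abs_nonneg _) (pow_le_one₀ hτ.1.le hτ.2)).trans
      (h _ ⟨mul_nonneg hr hτ.1.le, mul_le_of_le_one_right hr hτ.2⟩)
  simpa [ballAvg] using intervalIntegral.norm_integral_le_of_norm_le_const hbound

theorem ballAvg_sub (hg₁ : Continuous g₁) (hg₂ : Continuous g₂) :
    ballAvg m (fun t => g₁ t - g₂ t) r = ballAvg m g₁ r - ballAvg m g₂ r := by
  simp only [ballAvg, mul_sub]
  exact intervalIntegral.integral_sub (Continuous.intervalIntegrable (by fun_prop) _ _)
    (Continuous.intervalIntegrable (by fun_prop) _ _)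

theorem ballAvg_pos (hg : Continuous g) (hr : 0 ≤ r) (hg' : ∀ t ∈ Icc 0 r, 0 ≤ g t)
    (hg0 : 0 < g 0) : 0 < ballAvg m g r := by
  have hev : ∀ᶠ τ in 𝓝[>] (0 : ℝ), 0 < g (r * τ) := by
    have : Tendsto (fun τ => g (r * τ)) (𝓝 0) (𝓝 (g (r * 0))) :=
      Continuous.tendsto (by fun_prop) 0
    rw [mul_zero] at this
    exact (this.mono_left nhdsWithin_le_nhds).eventually_const_lt hg0
  obtain ⟨τ, hgτ, hτ⟩ := (hev.and (Ioo_mem_nhdsGT (zero_lt_one' ℝ))).exists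
  refine intervalIntegral.integral_pos zero_lt_one (Continuous.continuousOn (by fun_prop))
    (fun τ hτ => ?_) ⟨τ, Ioo_subset_Icc_self hτ, mul_pos (pow_pos hτ.1 m) hgτ⟩
  exact mul_nonneg (pow_nonneg hτ.1.le m)
    (hg' _ ⟨mul_nonneg hr hτ.1.le, mul_le_of_le_one_right hr hτ.2⟩)

end BallAvg

/-- Banach's fixed point theorem in the norm `sup |v| / ω`, with the fixed point depending
continuously on the inhomogeneity. -/
theorem exists_continuous_eq_const_sub {X : Type*} [TopologicalSpace X] [CompactSpace X]
    {ω : C(X, ℝ)} (hω : ∀ x, 1 ≤ ω x) {k : NNReal} (hk : k < 1) {J : C(X, ℝ) → C(X, ℝ)}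
    (hJ : ∀ v w D, (∀ x, |v x - w x| ≤ D * ω x) → ∀ x, |J v x - J w x| ≤ k * D * ω x) :
    ∃ V : ℝ → C(X, ℝ), Continuous V ∧ ∀ d x, V d x = d - J (V d) x := by
  have hω0 : ∀ x, 0 < ω x := fun x => one_pos.trans_le (hω x)
  let F : ℝ → C(X, ℝ) → C(X, ℝ) := fun d v =>
    ⟨fun x => (d - J (ω * v) x) / ω x, by fun_prop (disch := exact fun x => (hω0 x).ne')⟩
  have hF_apply : ∀ d v x, F d v x = (d - J (ω * v) x) / ω x := fun _ _ _ => rfl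
  have hF : ∀ d, ContractingWith k (F d) := fun d => by
    refine ⟨hk, LipschitzWith.of_dist_le_mul fun v w => ?_⟩
    rw [ContinuousMap.dist_le (by positivity)]
    intro x
    have hvw : ∀ x, |(ω * v) x - (ω * w) x| ≤ dist v w * ω x := fun x => by
      rw [ContinuousMap.mul_apply, ContinuousMap.mul_apply, ← mul_sub, abs_mul,
        abs_of_pos (hω0 x), mul_comm, ← Real.dist_eq]
      exact mul_le_mul_of_nonneg_right (ContinuousMap.dist_apply_le_dist x) (hω0 x).le
    rw [Real.dist_eq, hF_apply, hF_apply, ← sub_div, sub_sub_sub_cancel_left, abs_div,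
      abs_of_pos (hω0 x), div_le_iff₀ (hω0 x), abs_sub_comm]
    exact hJ _ _ _ hvw x
  let V : ℝ → C(X, ℝ) := fun d => (hF d).fixedPoint
  have hV : Continuous V := by
    refine (LipschitzWith.of_dist_le_mul (K := (1 - k)⁻¹) fun d d' => ?_).continuous
    rw [NNReal.coe_inv, NNReal.coe_sub hk.le, NNReal.coe_one, inv_mul_eq_div]
    refine (hF d).fixedPoint_lipschitz_in_map (hF d') fun v => ?_
    rw [ContinuousMap.dist_le dist_nonneg]
    intro x
    rw [Real.dist_eq, hF_apply, hF_apply, ← sub_div, sub_sub_sub_cancel_right, abs_div,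
      abs_of_pos (hω0 x)]
    exact div_le_self (abs_nonneg _) (hω x)
  refine ⟨fun d => ω * V d, continuous_const.mul hV, fun d x => ?_⟩
  have hfix : (d - J (ω * V d) x) / ω x = V d x :=
    DFunLike.congr_fun (hF d).fixedPoint_isFixedPt x
  rw [ContinuousMap.mul_apply, ← hfix, mul_div_cancel₀ _ (hω0 x).ne']

theorem abs_integral_sub_le_of_le_exp {a b : ℝ → ℝ} (ha : Continuous a) (hb : Continuous b)
    {C μ r : ℝ} (hC : 0 ≤ C) (hμ : 0 < μ) (hr : 0 ≤ r)
    (hab : ∀ s ∈ Icc 0 r, |a s - b s| ≤ C * Real.exp (μ * s)) :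
    |(∫ s in (0 : ℝ)..r, a s) - ∫ s in (0 : ℝ)..r, b s| ≤ C / μ * Real.exp (μ * r) := by
  have hexp : ∫ s in (0 : ℝ)..r, Real.exp (μ * s) = μ⁻¹ * (Real.exp (μ * r) - 1) := by
    simpa using intervalIntegral.integral_comp_mul_left (a := 0) (b := r) Real.exp hμ.ne'
  calc |(∫ s in (0 : ℝ)..r, a s) - ∫ s in (0 : ℝ)..r, b s|
      = |∫ s in (0 : ℝ)..r, (a s - b s)| := by
        rw [intervalIntegral.integral_sub (ha.intervalIntegrable _ _) (hb.intervalIntegrable _ _)]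
    _ ≤ ∫ s in (0 : ℝ)..r, C * Real.exp (μ * s) := by
        have hexpc : Continuous fun s => C * Real.exp (μ * s) := by fun_prop
        rw [← Real.norm_eq_abs]
        exact intervalIntegral.norm_integral_le_of_norm_le hr
          (Eventually.of_forall fun s hs => hab s (Ioc_subset_Icc_self hs))
          (hexpc.intervalIntegrable _ _)
    _ = C / μ * (Real.exp (μ * r) - 1) := by
        rw [intervalIntegral.integral_const_mul, hexp]
        ring
    _ ≤ C / μ * Real.exp (μ * r) := by
        gcongr
        linarith

theorem exists_volterra_solution {R : ℝ} {N : C(Icc 0 R, ℝ) → ℝ → ℝ}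
    (hN : ∀ v, Continuous (N v)) {L : NNReal}
    (hL : ∀ v w, ∀ s ∈ Icc 0 R, ∀ c, (∀ t : Icc 0 R, t ≤ s → |v t - w t| ≤ c) →
      |N v s - N w s| ≤ L * c) :
    ∃ V : ℝ → C(Icc 0 R, ℝ), Continuous V ∧
      ∀ d r, V d r = d - ∫ s in (0 : ℝ)..r, N (V d) s := by
  set μ : ℝ := 2 * L + 1
  have hμ : 0 < μ := by positivity
  let J : C(Icc 0 R, ℝ) → C(Icc 0 R, ℝ) := fun v => ⟨fun r => ∫ s in (0 : ℝ)..r, N v s,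
    (intervalIntegral.continuous_primitive (fun a b => (hN v).intervalIntegrable a b) 0).comp
      continuous_subtype_val⟩
  let ω : C(Icc 0 R, ℝ) := ⟨fun r => Real.exp (μ * r), by fun_prop⟩
  refine exists_continuous_eq_const_sub (ω := ω) (k := 1 / 2) (J := J)
    (fun r => Real.one_le_exp (mul_nonneg hμ.le r.2.1)) ?_ fun v w D hD r => ?_
  · rw [← NNReal.coe_lt_coe]
    norm_num
  have hD0 : 0 ≤ D := nonneg_of_mul_nonneg_left ((abs_nonneg _).trans (hD r)) (Real.exp_pos _)
  have hint := abs_integral_sub_le_of_le_exp (hN v) (hN w) (C := L * D) (by positivity) hμ r.2.1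
    fun s hs => by
      rw [mul_assoc]
      refine hL v w s ⟨hs.1, hs.2.trans r.2.2⟩ _ fun t ht => (hD t).trans ?_
      exact mul_le_mul_of_nonneg_left (Real.exp_le_exp.2 (by gcongr)) hD0
  refine hint.trans (mul_le_mul_of_nonneg_right ?_ (Real.exp_pos _).le)
  rw [div_le_iff₀ hμ]
  simp only [μ]
  push_cast
  linarith

theorem exists_continuous_shooting (m : ℕ) {R : ℝ} (hR : 0 ≤ R) (k : C(Icc 0 R, ℝ))
    {f ψ : ℝ → ℝ} {Lf Lψ : NNReal} (hf : LipschitzWith Lf f) (hψ : LipschitzWith Lψ ψ) :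
    ∃ V : ℝ → C(Icc 0 R, ℝ), Continuous V ∧ ∀ d r, V d r =
      d - ∫ s in (0 : ℝ)..r, ψ (s * ballAvg m (IccExtend hR fun t => k t * f (V d t)) s) := by
  have hfc := hf.continuous
  have hsource : ∀ v : C(Icc 0 R, ℝ), Continuous (IccExtend hR fun t => k t * f (v t)) :=
    fun v => Continuous.Icc_extend' (by fun_prop)
  refine exists_volterra_solution (L := Lψ * (R.toNNReal * (‖k‖₊ * Lf)))
    (N := fun v s => ψ (s * ballAvg m (IccExtend hR fun t => k t * f (v t)) s))
    (fun v => hψ.continuous.comp (continuous_id.mul (continuous_ballAvg (hsource v))))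
    fun v w s hs c hc => ?_
  have havg : |ballAvg m (IccExtend hR fun t => k t * f (v t)) s -
      ballAvg m (IccExtend hR fun t => k t * f (w t)) s| ≤ ‖k‖ * (Lf * c) := by
    rw [← ballAvg_sub (hsource v) (hsource w)]
    refine abs_ballAvg_le hs.1 fun t ht => ?_
    have htR : t ∈ Icc 0 R := ⟨ht.1, ht.2.trans hs.2⟩
    rw [IccExtend_of_mem _ _ htR, IccExtend_of_mem _ _ htR, ← mul_sub, abs_mul]
    have hft := hf.dist_le_mul (v ⟨t, htR⟩) (w ⟨t, htR⟩)
    rw [Real.dist_eq, Real.dist_eq] at hft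
    have hkt := k.norm_coe_le_norm ⟨t, htR⟩
    rw [Real.norm_eq_abs] at hkt
    gcongr
    exact hft.trans (mul_le_mul_of_nonneg_left (hc ⟨t, htR⟩ ht.2) Lf.2)
  calc |ψ (s * ballAvg m (IccExtend hR fun t => k t * f (v t)) s) -
        ψ (s * ballAvg m (IccExtend hR fun t => k t * f (w t)) s)|
      ≤ Lψ * (s * |ballAvg m (IccExtend hR fun t => k t * f (v t)) s -
          ballAvg m (IccExtend hR fun t => k t * f (w t)) s|) := by
        have := hψ.dist_le_mul (s * ballAvg m (IccExtend hR fun t => k t * f (v t)) s)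
          (s * ballAvg m (IccExtend hR fun t => k t * f (w t)) s)
        rwa [Real.dist_eq, Real.dist_eq, ← mul_sub, abs_mul, abs_of_nonneg hs.1] at this
    _ ≤ Lψ * (R * (‖k‖ * (Lf * c))) := by
        have := hs.2
        gcongr
    _ = _ := by
        push_cast
        rw [Real.coe_toNNReal _ hR]
        ring

/-- The power `x ↦ x^s` with `x` truncated to `[0, D]`; it is globally Lipschitz for `s ≥ 1`. -/
def clampPow (D s x : ℝ) : ℝ := max 0 (min D x) ^ s

section ClampPow

variable {D s x : ℝ}

theorem clampPow_nonneg (D s x : ℝ) : 0 ≤ clampPow D s x :=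
  Real.rpow_nonneg (le_max_left _ _) _

theorem clampPow_of_le (h : x ≤ D) : clampPow D s x = max 0 x ^ s := by
  rw [clampPow, min_eq_right h]

theorem clampPow_of_mem (h : x ∈ Icc 0 D) : clampPow D s x = x ^ s := by
  rw [clampPow_of_le h.2, max_eq_right h.1]

theorem exists_lipschitzWith_clampPow (hD : 0 ≤ D) (hs : 1 ≤ s) :
    ∃ L : NNReal, LipschitzWith L (clampPow D s) := by
  have hpow : LipschitzOnWith (s * D ^ (s - 1)).toNNReal (fun x : ℝ => x ^ s) (Icc 0 D) := by
    refine (convex_Icc 0 D).lipschitzOnWith_of_nnnorm_deriv_le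
      (fun x _ => (Real.hasDerivAt_rpow_const (Or.inr hs)).differentiableAt) fun x hx => ?_
    rw [(Real.hasDerivAt_rpow_const (Or.inr hs)).deriv, ← NNReal.coe_le_coe, coe_nnnorm,
      Real.coe_toNNReal _ (by positivity), Real.norm_of_nonneg
      (mul_nonneg (by linarith) (Real.rpow_nonneg hx.1 _))]
    exact mul_le_mul_of_nonneg_left (Real.rpow_le_rpow hx.1 hx.2 (by linarith)) (by linarith)
  have hproj : LipschitzWith 1 fun x => (projIcc 0 D hD x : ℝ) :=
    (LipschitzWith.subtype_val (Icc 0 D)).comp (LipschitzWith.projIcc hD) |>.weaken (by simp)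
  exact ⟨_, lipschitzOnWith_univ.1
    (hpow.comp hproj.lipschitzOnWith fun x _ => (projIcc 0 D hD x).2)⟩

end ClampPow

/-! ### Shooting -/

/-- The solution `U` on `[0, R]` of the radial equation with `U(0) = d`, regular at the centre,
where the nonlinearity `U ^ γ` is extended by `0` to negative values of `U`. As in
`RadialProfile`, `|U'| ^ (1 / σ) = r * b r`. -/
structure IsShootingSolution (n : ℕ) (σ γ : ℝ) (K : ℝ → ℝ) (R M d : ℝ) (U b : ℝ → ℝ) : Prop where
  U_cont : Continuous U
  b_cont : Continuous b
  U_zero : U 0 = d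
  b_zero : n * b 0 = K 0 * d ^ γ
  b_pos : ∀ r ∈ Icc 0 R, 0 < b r
  b_le : ∀ r ∈ Icc 0 R, b r ≤ M * d ^ γ
  U_deriv : ∀ r ∈ Icc 0 R, HasDerivAt U (-(r * b r) ^ σ) r
  b_deriv : ∀ r ∈ Ioo 0 R, HasDerivAt b ((K r * max 0 (U r) ^ γ - n * b r) / r) r

section Existence

variable {m n : ℕ} {σ γ R M D W d : ℝ} {K U g : ℝ → ℝ}

theorem hasDerivAt_of_eq_const_sub_integral {f : ℝ → ℝ} (hf : Continuous f)
    (hU : ∀ r, U r = d - ∫ s in 0..r, f s) (r : ℝ) : HasDerivAt U (-f r) r :=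
  ((hf.integral_hasStrictDerivAt 0 r).hasDerivAt.const_sub d).congr_of_eventuallyEq
    (Eventually.of_forall hU)

theorem ballAvg_mem_Ioc {c r : ℝ} (hg : Continuous g) (hr : 0 ≤ r)
    (h : ∀ t ∈ Icc 0 r, g t ∈ Icc 0 c) (h0 : 0 < g 0) : ballAvg m g r ∈ Ioc 0 c :=
  ⟨ballAvg_pos hg hr (fun t ht => (h t ht).1) h0, (le_abs_self _).trans <|
    abs_ballAvg_le hr fun t ht => (abs_of_nonneg (h t ht).1).trans_le (h t ht).2⟩

/-- Since `U` decreases from `d ≤ D` and `b ≤ M * d ^ γ`, neither truncation is active. -/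
theorem isShootingSolution_of_eq_integral (hR : 0 ≤ R) (hγ : 0 ≤ γ) (hd : d ∈ Ioc 0 D)
    (hKpos : ∀ r ∈ Icc 0 R, 0 < K r) (hKM : ∀ r ∈ Icc 0 R, K r ≤ M)
    (hW : R * (M * D ^ γ) ≤ W) (hψ : Continuous (clampPow W σ)) (hg : Continuous g)
    (hgU : ∀ t ∈ Icc 0 R, g t = K t * clampPow D γ (U t))
    (hU : ∀ r, U r = d - ∫ s in 0..r, clampPow W σ (s * ballAvg m g s)) :
    IsShootingSolution (m + 1) σ γ K R M d U (ballAvg m g) := by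
  have hzero : (0 : ℝ) ∈ Icc 0 R := ⟨le_rfl, hR⟩
  have hU' := hasDerivAt_of_eq_const_sub_integral
    (hψ.comp (continuous_id.mul (continuous_ballAvg hg))) hU
  have hU0 : U 0 = d := by rw [hU, intervalIntegral.integral_same, sub_zero]
  have hanti : Antitone U :=
    antitone_of_hasDerivAt_nonpos hU' fun _ => neg_nonpos.2 (clampPow_nonneg _ _ _)
  have hUle : ∀ r ∈ Icc 0 R, U r ≤ d := fun r hr => hU0 ▸ hanti hr.1
  have hgmax : ∀ t ∈ Icc 0 R, g t = K t * max 0 (U t) ^ γ := fun t ht => by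
    rw [hgU t ht, clampPow_of_le ((hUle t ht).trans hd.2)]
  have hg0 : g 0 = K 0 * d ^ γ := by rw [hgmax 0 hzero, hU0, max_eq_right hd.1.le]
  have hM : 0 ≤ M := (hKpos 0 hzero).le.trans (hKM 0 hzero)
  have hgmem : ∀ t ∈ Icc 0 R, g t ∈ Icc 0 (M * d ^ γ) := fun t ht => by
    have := (hKpos t ht).le
    have := hKM t ht
    have := max_le hd.1.le (hUle t ht)
    rw [hgmax t ht]
    exact ⟨by positivity, by gcongr⟩
  have hb : ∀ r ∈ Icc 0 R, ballAvg m g r ∈ Ioc 0 (M * d ^ γ) := fun r hr =>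
    ballAvg_mem_Ioc hg hr.1 (fun t ht => hgmem t ⟨ht.1, ht.2.trans hr.2⟩)
      (hg0 ▸ mul_pos (hKpos 0 hzero) (Real.rpow_pos_of_pos hd.1 γ))
  refine ⟨continuous_iff_continuousAt.2 fun r => (hU' r).continuousAt, continuous_ballAvg hg, hU0,
    ?_, fun r hr => (hb r hr).1,
    fun r hr => (hb r hr).2, fun r hr => (hU' r).congr_deriv ?_, fun r hr => ?_⟩
  · rw [ballAvg_zero, hg0]
    push_cast
    field_simp
  · have hslope : r * ballAvg m g r ≤ W := by
      refine le_trans (mul_le_mul hr.2 ((hb r hr).2.trans ?_) (hb r hr).1.le hR) hW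
      have := hd.1
      have := hd.2
      gcongr
    exact congrArg Neg.neg (clampPow_of_mem ⟨mul_nonneg hr.1 (hb r hr).1.le, hslope⟩)
  · rw [← hgmax r (Ioo_subset_Icc_self hr)]
    exact_mod_cast hasDerivAt_ballAvg hg hr.1.ne'

theorem exists_isShootingSolution_family (hn : n ≠ 0) (hσ : 1 ≤ σ) (hγ : 1 ≤ γ) (hR : 0 ≤ R)
    (hK : ContinuousOn K (Icc 0 R)) (hKpos : ∀ r ∈ Icc 0 R, 0 < K r) (hD : 0 ≤ D) :
    ∃ (M : ℝ) (U b : ℝ → ℝ → ℝ), 0 ≤ M ∧ (Continuous fun d => U d R) ∧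
      ∀ d ∈ Ioc 0 D, IsShootingSolution n σ γ K R M d (U d) (b d) := by
  obtain ⟨m, rfl⟩ := Nat.exists_eq_succ_of_ne_zero hn
  obtain ⟨M, hM⟩ : ∃ M, ∀ t ∈ Icc 0 R, K t ≤ M := by
    obtain ⟨M, hM⟩ := isCompact_Icc.exists_bound_of_continuousOn hK
    exact ⟨M, fun t ht => (le_abs_self _).trans (hM t ht)⟩
  have hM0 : 0 ≤ M := (hKpos 0 ⟨le_rfl, hR⟩).le.trans (hM 0 ⟨le_rfl, hR⟩)
  obtain ⟨Lf, hf⟩ := exists_lipschitzWith_clampPow hD hγ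
  obtain ⟨Lψ, hψ⟩ :=
    exists_lipschitzWith_clampPow (D := R * (M * D ^ γ)) (by positivity) hσ
  obtain ⟨V, hVc, hV⟩ :=
    exists_continuous_shooting m hR ⟨_, continuousOn_iff_continuous_domRestrict.1 hK⟩ hf hψ
  set g : ℝ → ℝ → ℝ := fun d => IccExtend hR fun t => K t * clampPow D γ (V d t)
  set U : ℝ → ℝ → ℝ := fun d r =>
    d - ∫ s in 0..r, clampPow (R * (M * D ^ γ)) σ (s * ballAvg m (g d) s)
  have hUV : ∀ d, ∀ r : Icc 0 R, U d r = V d r := fun d r => (hV d r).symm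
  have hg : ∀ d, Continuous (g d) := fun d =>
    ((continuousOn_iff_continuous_domRestrict.1 hK).mul
      (hf.continuous.comp (V d).continuous)).Icc_extend'
  refine ⟨M, U, fun d => ballAvg m (g d), hM0, ?_, fun d hd =>
    isShootingSolution_of_eq_integral hR (by linarith) hd hKpos hM le_rfl hψ.continuous (hg d)
      (fun t ht => ?_) fun r => rfl⟩
  · exact ((continuous_eval_const (⟨R, hR, le_rfl⟩ : Icc 0 R)).comp hVc).congr fun d =>
      (hUV d ⟨R, hR, le_rfl⟩).symm
  · rw [hUV d ⟨t, ht⟩]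
    exact IccExtend_of_mem hR _ ht

end Existence

namespace IsShootingSolution

variable {n : ℕ} {σ γ R M d : ℝ} {K U b : ℝ → ℝ}

theorem strictAntiOn (h : IsShootingSolution n σ γ K R M d U b) : StrictAntiOn U (Icc 0 R) := by
  refine strictAntiOn_of_deriv_neg (convex_Icc 0 R) h.U_cont.continuousOn fun r hr => ?_
  rw [interior_Icc] at hr
  rw [(h.U_deriv r (Ioo_subset_Icc_self hr)).deriv]
  exact neg_neg_of_pos
    (Real.rpow_pos_of_pos (mul_pos hr.1 (h.b_pos r (Ioo_subset_Icc_self hr))) σ)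

theorem U_pos (h : IsShootingSolution n σ γ K R M d U b) (hUR : 0 ≤ U R) {r : ℝ}
    (hr : r ∈ Ico 0 R) : 0 < U r :=
  hUR.trans_lt (h.strictAntiOn (Ico_subset_Icc_self hr) ⟨hr.1.trans hr.2.le, le_rfl⟩ hr.2)

theorem b_deriv_of_nonneg (h : IsShootingSolution n σ γ K R M d U b) (hUR : 0 ≤ U R) {r : ℝ}
    (hr : r ∈ Ioo 0 R) : HasDerivAt b ((K r * U r ^ γ - n * b r) / r) r :=
  max_eq_right (h.U_pos hUR (Ioo_subset_Ico_self hr)).le ▸ h.b_deriv r hr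

theorem radialProfile {α : ℝ} (h : IsShootingSolution n σ (n * α - 1) K R M d U b) (hn : n ≠ 0)
    (hKpos : ∀ r ∈ Ioo 0 R, 0 < K r) (hUR : 0 ≤ U R) : RadialProfile n σ α K R d U b where
  K_pos := hKpos
  U_tendsto := h.U_zero ▸ h.U_cont.continuousWithinAt.tendsto
  w_tendsto := by
    have hw : Continuous fun r => r ^ n * b r := (continuous_pow n).mul h.b_cont
    simpa [hn] using (hw.continuousWithinAt (s := Ioi 0) (x := 0)).tendsto
  U_pos _ hr := h.U_pos hUR (Ioo_subset_Ico_self hr)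
  U_deriv r hr := h.U_deriv r (Ioo_subset_Icc_self hr)
  b_deriv _ hr := h.b_deriv_of_nonneg hUR hr

theorem sub_le (h : IsShootingSolution n σ γ K R M d U b) (hσ : 0 ≤ σ) (hR : 0 < R) :
    d - R * (R * (M * d ^ γ)) ^ σ ≤ U R := by
  obtain ⟨r, hr, hslope⟩ := exists_hasDerivAt_eq_slope U (fun r => -(r * b r) ^ σ) hR
    h.U_cont.continuousOn fun t ht => h.U_deriv t (Ioo_subset_Icc_self ht)
  rw [sub_zero, h.U_zero, eq_div_iff hR.ne'] at hslope
  have hrR := Ioo_subset_Icc_self hr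
  have hb := h.b_pos r hrR
  have hle : (r * b r) ^ σ ≤ (R * (M * d ^ γ)) ^ σ :=
    Real.rpow_le_rpow (mul_nonneg hrR.1 hb.le)
      (mul_le_mul hrR.2 (h.b_le r hrR) hb.le hR.le) hσ
  nlinarith

end IsShootingSolution

theorem eventually_lt_self_of_superlinear {σ γ R M : ℝ} (hσγ : 1 < γ * σ) (hR : 0 ≤ R)
    (hM : 0 ≤ M) : ∀ᶠ d : ℝ in 𝓝[>] 0, R * (R * (M * d ^ γ)) ^ σ < d := by
  have hlim := tendsto_const_mul_rpow_zero (R * (R * M) ^ σ) (sub_pos.2 hσγ)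
  filter_upwards [hlim.eventually_lt_const one_pos, self_mem_nhdsWithin] with d hlt hd
  rw [mem_Ioi] at hd
  calc R * (R * (M * d ^ γ)) ^ σ = R * (R * M) ^ σ * d ^ (γ * σ - 1) * d := by
        rw [← mul_assoc R M, Real.mul_rpow (by positivity) (by positivity), ← Real.rpow_mul hd.le,
          mul_assoc _ _ d, ← Real.rpow_add_one hd.ne', sub_add_cancel, mul_assoc]
    _ < 1 * d := mul_lt_mul_of_pos_right hlt hd
    _ = d := one_mul d

/-- Continuity in `d` of the value `U(R)`, which is positive for small `d`, reduces the boundary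
condition to finding one height `D` from which the solution has crossed zero before `R`. -/
theorem exists_isShootingSolution_eq_zero {n : ℕ} {σ γ R D : ℝ} {K : ℝ → ℝ} (hn : n ≠ 0)
    (hσ : 1 ≤ σ) (hγ : 1 ≤ γ) (hσγ : 1 < γ * σ) (hR : 0 < R) (hK : ContinuousOn K (Icc 0 R))
    (hKpos : ∀ r ∈ Icc 0 R, 0 < K r) (hD : 0 < D)
    (hcross : ∀ M U b, IsShootingSolution n σ γ K R M D U b → U R ≤ 0) :
    ∃ M d U b, IsShootingSolution n σ γ K R M d U b ∧ U R = 0 := by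
  obtain ⟨M, U, b, hM, hUR, hsol⟩ := exists_isShootingSolution_family hn hσ hγ hR.le hK hKpos hD.le
  obtain ⟨δ, hδlt, hδ⟩ :=
    ((eventually_lt_self_of_superlinear hσγ hR.le hM).and (Ioc_mem_nhdsGT hD)).exists
  have hδR : 0 ≤ U δ R := (sub_pos.2 hδlt).le.trans ((hsol δ hδ).sub_le (by linarith) hR)
  obtain ⟨d, hd, hdR⟩ := intermediate_value_Icc' hδ.2 hUR.continuousOn
    ⟨hcross M (U D) (b D) (hsol D ⟨hD, le_rfl⟩), hδR⟩
  exact ⟨M, d, U d, b d, hsol d ⟨hδ.1.trans_le hd.1, hd.2⟩, hdR⟩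

/-! ### Radial functions on Euclidean space -/

section RadialCalculus

variable {E : Type*} [NormedAddCommGroup E] [InnerProductSpace ℝ E] {x : E}

theorem hasFDerivAt_norm_of_ne_zero (hx : x ≠ 0) :
    HasFDerivAt (fun y : E => ‖y‖) (‖x‖⁻¹ • innerSL ℝ x) x := by
  have hx' : ‖x‖ ≠ 0 := norm_ne_zero_iff.2 hx
  have hsqrt := (hasStrictFDerivAt_norm_sq x).hasFDerivAt.sqrt (pow_ne_zero 2 hx')
  simp only [Real.sqrt_sq (norm_nonneg _)] at hsqrt
  refine hsqrt.congr_fderiv ?_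
  ext y
  simp only [smul_apply, smul_eq_mul, nsmul_eq_mul]
  field_simp
  norm_num

theorem hasFDerivAt_comp_norm {f : ℝ → ℝ} {f' : ℝ} (hx : x ≠ 0) (hf : HasDerivAt f f' ‖x‖) :
    HasFDerivAt (fun y : E => f ‖y‖) ((f' / ‖x‖) • innerSL ℝ x) x := by
  rw [div_eq_mul_inv, ← smul_smul]
  exact hf.comp_hasFDerivAt x (hasFDerivAt_norm_of_ne_zero hx)

theorem hasGradientAt_comp_norm [CompleteSpace E] {f : ℝ → ℝ} {f' : ℝ}
    (hf : HasDerivAt f f' ‖x‖) (h0 : x = 0 → f' = 0) :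
    HasGradientAt (fun y : E => f ‖y‖) ((f' / ‖x‖) • x) x := by
  obtain rfl | hx := eq_or_ne x 0
  · rw [h0 rfl, norm_zero, hasDerivAt_iff_isLittleO] at hf
    rw [smul_zero, hasGradientAt_iff_isLittleO]
    refine ((hf.comp_tendsto tendsto_norm_zero).congr (fun y => ?_)
      fun y => ?_).trans_isBigO (Asymptotics.isBigO_refl _ _).norm_left
    · simp
    · simp
  · rw [hasGradientAt_iff_hasFDerivAt, map_smul]
    exact hasFDerivAt_comp_norm hx hf

theorem continuous_div_norm_smul {f : ℝ → ℝ} (hf : Continuous f) (h0 : f 0 = 0) :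
    Continuous fun x : E => (f ‖x‖ / ‖x‖) • x := by
  refine continuous_iff_continuousAt.2 fun x => ?_
  obtain rfl | hx := eq_or_ne x 0
  · rw [ContinuousAt, smul_zero]
    refine squeeze_zero_norm (a := fun x => |f ‖x‖|) (fun x => ?_) ?_
    · rw [norm_smul, norm_div, norm_norm, Real.norm_eq_abs, div_mul_eq_mul_div, mul_div_assoc]
      exact mul_le_of_le_one_right (abs_nonneg _) (div_self_le_one _)
    · simpa [h0] using (hf.comp continuous_norm).abs.tendsto (0 : E)
  · have hx' : ‖x‖ ≠ 0 := norm_ne_zero_iff.2 hx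
    fun_prop (disch := assumption)

theorem hasFDerivAt_comp_norm_smul {b : ℝ → ℝ} {b' : ℝ} (h0 : x = 0 → ContinuousAt b 0)
    (hb : x ≠ 0 → HasDerivAt b b' ‖x‖) :
    HasFDerivAt (fun y : E => b ‖y‖ • y) (b ‖x‖ • ContinuousLinearMap.id ℝ E +
      ((b' / ‖x‖) • innerSL ℝ x).smulRight x) x := by
  obtain rfl | hx := eq_or_ne x 0
  · rw [hasFDerivAt_iff_isLittleO]
    have hlim : Tendsto (fun y : E => b ‖y‖ - b 0) (𝓝 0) (𝓝 0) := by
      simpa using ((h0 rfl).tendsto.comp tendsto_norm_zero).sub_const (b 0)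
    refine (((Asymptotics.isLittleO_one_iff ℝ).2 hlim).smul_isBigO
      (Asymptotics.isBigO_refl (fun y : E => y) (𝓝 0))).congr (fun y => ?_) fun y => ?_
    · simp [sub_smul]
    · simp
  · exact (hasFDerivAt_comp_norm hx (hb hx)).smul (hasFDerivAt_id x)

theorem contDiffOn_one_of_hasGradientAt [CompleteSpace E] {f : E → ℝ} {G : E → E} {s : Set E}
    (hs : IsOpen s) (hG : Continuous G) (h : ∀ x ∈ s, HasGradientAt f (G x) x) :
    ContDiffOn ℝ 1 f s := by
  have hsucc : ContDiffOn ℝ (0 + 1) f s := by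
    rw [contDiffOn_succ_iff_fderiv_of_isOpen hs, contDiffOn_zero]
    refine ⟨fun x hx => (h x hx).differentiableAt.differentiableWithinAt, by simp, ?_⟩
    exact ((InnerProductSpace.toDual ℝ E).continuous.comp hG).continuousOn.congr fun x hx =>
      (hasGradientAt_iff_hasFDerivAt.1 (h x hx)).fderiv
  simpa using hsucc

end RadialCalculus

theorem divergence_of_hasFDerivAt {n : ℕ}
    {V : EuclideanSpace ℝ (Fin n) → EuclideanSpace ℝ (Fin n)} {x : EuclideanSpace ℝ (Fin n)}
    {β γ : ℝ} (hV : HasFDerivAt V (β • ContinuousLinearMap.id ℝ _ +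
      ((γ / ‖x‖) • innerSL ℝ x).smulRight x) x) :
    divergence V x = n * β + γ * ‖x‖ := by
  have hnorm : γ * ‖x‖ = γ / ‖x‖ * ‖x‖ ^ 2 := by
    obtain hx | hx := eq_or_ne ‖x‖ 0
    · simp [hx]
    · field_simp
  have hterm : ∀ i, fderiv ℝ V x (EuclideanSpace.single i 1) i = β + γ / ‖x‖ * x i ^ 2 := by
    intro i
    rw [hV.fderiv]
    simp only [add_apply, smul_apply, ContinuousLinearMap.id_apply,
      ContinuousLinearMap.smulRight_apply, coe_innerSL_apply, EuclideanSpace.inner_single_right,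
      Real.ringHom_apply, one_mul, smul_eq_mul, PiLp.add_apply, PiLp.smul_apply,
      PiLp.single_eq_same, mul_one, add_right_inj]
    ring
  rw [divergence, Finset.sum_congr rfl fun i _ => hterm i, hnorm,
    EuclideanSpace.real_norm_sq_eq, Finset.mul_sum, Finset.sum_add_distrib]
  simp

theorem flux_of_gradient_eq {n : ℕ} {p c : ℝ} {u : EuclideanSpace ℝ (Fin n) → ℝ}
    {x : EuclideanSpace ℝ (Fin n)} (h : gradient u x = (c / ‖x‖) • x) :
    flux p u x = (|c| ^ (p - 2) * c / ‖x‖) • x := by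
  obtain rfl | hx := eq_or_ne x 0
  · rw [flux, h, smul_zero, smul_zero, smul_zero]
  · rw [flux, h, norm_smul, norm_div, norm_norm, div_mul_cancel₀ _ (norm_ne_zero_iff.2 hx),
      smul_smul, Real.norm_eq_abs, mul_div_assoc]

theorem abs_rpow_mul_self_eq_neg_iff {p σ s c : ℝ} (hσ : σ * (p - 1) = 1) (hs : 0 < s) :
    |c| ^ (p - 2) * c = -s ↔ c = -s ^ σ := by
  have hpow {y : ℝ} (hy : 0 < y) : y ^ (p - 2) * y = y ^ (p - 1) := by
    rw [← Real.rpow_add_one hy.ne']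
    ring_nf
  constructor
  · intro h
    have hc : 0 < -c := by
      by_contra! hc
      have : 0 ≤ |c| ^ (p - 2) * c := mul_nonneg (by positivity) (by linarith)
      linarith
    have hs' : s = (-c) ^ (p - 1) := by
      rw [abs_of_neg (neg_pos.1 hc)] at h
      linarith [hpow hc]
    rw [hs', ← Real.rpow_mul hc.le, mul_comm, hσ, Real.rpow_one, neg_neg]
  · rintro rfl
    have hsσ := Real.rpow_pos_of_pos hs σ
    rw [abs_neg, abs_of_pos hsσ, mul_neg, hpow hsσ, ← Real.rpow_mul hs.le, hσ, Real.rpow_one]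

theorem mul_abs_rpow_of_pos {v q : ℝ} (hv : 0 < v) : v * |v| ^ (q - 2) = v ^ (q - 1) := by
  rw [abs_of_pos hv, mul_comm, ← Real.rpow_add_one hv.ne']
  ring_nf

namespace IsShootingSolution

variable {n : ℕ} {p σ γ R M d : ℝ} {K U b : ℝ → ℝ} {x : EuclideanSpace ℝ (Fin n)}

theorem hasGradientAt (h : IsShootingSolution n σ γ K R M d U b) (hσ : 0 < σ)
    (hx : x ∈ Metric.ball 0 R) :
    HasGradientAt (fun y => U ‖y‖) ((-(‖x‖ * b ‖x‖) ^ σ / ‖x‖) • x) x := by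
  rw [mem_ball_zero_iff] at hx
  refine hasGradientAt_comp_norm (h.U_deriv _ ⟨norm_nonneg x, hx.le⟩) ?_
  rintro rfl
  rw [norm_zero, zero_mul, Real.zero_rpow hσ.ne', neg_zero]

theorem flux_eq (h : IsShootingSolution n σ γ K R M d U b) (hσ : 0 < σ) (hσp : σ * (p - 1) = 1)
    (hx : x ∈ Metric.ball 0 R) : flux p (fun y => U ‖y‖) x = (-b ‖x‖) • x := by
  rw [flux_of_gradient_eq (h.hasGradientAt hσ hx).gradient]
  obtain rfl | hx0 := eq_or_ne x 0
  · rw [smul_zero, smul_zero]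
  · have hnorm := norm_pos_iff.2 hx0
    rw [mem_ball_zero_iff] at hx
    rw [(abs_rpow_mul_self_eq_neg_iff hσp
      (mul_pos hnorm (h.b_pos _ ⟨hnorm.le, hx.le⟩))).2 rfl, neg_div,
      mul_div_cancel_left₀ _ hnorm.ne']

theorem hasFDerivAt_flux (h : IsShootingSolution n σ γ K R M d U b) (hσ : 0 < σ)
    (hσp : σ * (p - 1) = 1) (hUR : 0 ≤ U R) (hx : x ∈ Metric.ball 0 R) :
    HasFDerivAt (flux p fun y => U ‖y‖) ((-b ‖x‖) • ContinuousLinearMap.id ℝ _ +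
      ((-((K ‖x‖ * U ‖x‖ ^ γ - n * b ‖x‖) / ‖x‖) / ‖x‖) • innerSL ℝ x).smulRight x) x := by
  refine (hasFDerivAt_comp_norm_smul (b := fun r => -b r)
    (fun _ => h.b_cont.neg.continuousAt) fun hx0 => ?_).congr_of_eventuallyEq ?_
  · rw [mem_ball_zero_iff] at hx
    exact (h.b_deriv_of_nonneg hUR ⟨norm_pos_iff.2 hx0, hx⟩).neg
  · filter_upwards [Metric.isOpen_ball.mem_nhds hx] with y hy
    exact h.flux_eq hσ hσp hy

theorem pLaplacian_eq (h : IsShootingSolution n σ γ K R M d U b) (hσ : 0 < σ)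
    (hσp : σ * (p - 1) = 1) (hUR : 0 ≤ U R) (hx : x ∈ Metric.ball 0 R) :
    pLaplacian p (fun y => U ‖y‖) x = -(K ‖x‖ * U ‖x‖ ^ γ) := by
  rw [pLaplacian, divergence_of_hasFDerivAt (h.hasFDerivAt_flux hσ hσp hUR hx)]
  obtain rfl | hx0 := eq_or_ne x 0
  · rw [norm_zero, h.U_zero, ← h.b_zero]
    ring
  · have := norm_ne_zero_iff.2 hx0
    field_simp
    ring

theorem isPosRadialSolution (h : IsShootingSolution n σ (critExp n p - 1) K R M d U b)
    (hσ : 0 < σ) (hσp : σ * (p - 1) = 1) (hUR : U R = 0) :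
    IsPosRadialSolution n p K R fun x => U ‖x‖ := by
  have hpos : ∀ x ∈ Metric.ball (0 : EuclideanSpace ℝ (Fin n)) R, 0 < U ‖x‖ := fun x hx =>
    h.U_pos hUR.ge ⟨norm_nonneg x, mem_ball_zero_iff.1 hx⟩
  have hslope : Continuous fun r => -(r * b r) ^ σ :=
    ((continuous_id.mul h.b_cont).rpow_const fun _ => Or.inr hσ.le).neg
  exact
    { radial := fun x _ y _ hxy => congrArg U hxy
      cont := (h.U_cont.comp continuous_norm).continuousOn
      contDiff := contDiffOn_one_of_hasGradientAt Metric.isOpen_ball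
        (continuous_div_norm_smul hslope (by simp [hσ.ne'])) fun x hx => h.hasGradientAt hσ hx
      flux_diff := fun x hx =>
        (h.hasFDerivAt_flux hσ hσp hUR.ge hx).differentiableAt.differentiableWithinAt
      eqn := fun x hx => by
        rw [h.pLaplacian_eq hσ hσp hUR.ge hx, mul_abs_rpow_of_pos (hpos x hx), neg_add_cancel]
      pos := hpos
      boundary := fun x hx => by rw [mem_sphere_zero_iff_norm.1 hx, hUR] }

end IsShootingSolution

/-- The restriction of `u` to the ray through the unit vector `e`. -/
def rayValue {n : ℕ} (u : EuclideanSpace ℝ (Fin n) → ℝ) (e : EuclideanSpace ℝ (Fin n)) (r : ℝ) :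
    ℝ :=
  u (r • e)

/-- The function `b` with `∇u |∇u|^{p-2} = -b(|x|) x`, read off along the ray through the unit
vector `e` when `u` is radial. -/
def rayFlux {n : ℕ} (p : ℝ) (u : EuclideanSpace ℝ (Fin n) → ℝ) (e : EuclideanSpace ℝ (Fin n))
    (r : ℝ) : ℝ :=
  -inner ℝ (flux p u (r • e)) e / r

section Ray

variable {n : ℕ} {R r : ℝ} {e : EuclideanSpace ℝ (Fin n)}

theorem norm_smul_of_norm_eq_one (he : ‖e‖ = 1) (hr : 0 ≤ r) : ‖r • e‖ = r := by
  rw [norm_smul_of_nonneg hr, he, mul_one]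

theorem smul_mem_ball (he : ‖e‖ = 1) (hr : r ∈ Ico 0 R) : r • e ∈ Metric.ball 0 R := by
  rw [mem_ball_zero_iff, norm_smul_of_norm_eq_one he hr.1]
  exact hr.2

theorem smul_mem_closedBall (he : ‖e‖ = 1) (hr : r ∈ Icc 0 R) :
    r • e ∈ Metric.closedBall 0 R := by
  rw [mem_closedBall_zero_iff, norm_smul_of_norm_eq_one he hr.1]
  exact hr.2

end Ray

namespace IsPosRadialSolution

variable {n : ℕ} {p σ R r : ℝ} {K : ℝ → ℝ} {u : EuclideanSpace ℝ (Fin n) → ℝ}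
  {e x : EuclideanSpace ℝ (Fin n)}

theorem differentiableAt_rayValue (h : IsPosRadialSolution n p K R u) (he : ‖e‖ = 1)
    (hr : r ∈ Ico 0 R) : DifferentiableAt ℝ (rayValue u e) r :=
  ((h.contDiff.differentiableOn one_ne_zero).differentiableAt
    (Metric.isOpen_ball.mem_nhds (smul_mem_ball he hr))).comp r
    (differentiableAt_id.smul_const e)

theorem eq_rayValue (h : IsPosRadialSolution n p K R u) (he : ‖e‖ = 1)
    (hx : x ∈ Metric.ball 0 R) : u x = rayValue u e ‖x‖ :=
  h.radial x (Metric.ball_subset_closedBall hx) _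
    (smul_mem_closedBall he ⟨norm_nonneg x, (mem_ball_zero_iff.1 hx).le⟩)
    (norm_smul_of_norm_eq_one he (norm_nonneg x)).symm

theorem gradient_eq (h : IsPosRadialSolution n p K R u) (he : ‖e‖ = 1) (hx : x ∈ Metric.ball 0 R)
    (hx0 : x ≠ 0) : gradient u x = (deriv (rayValue u e) ‖x‖ / ‖x‖) • x := by
  have hray := h.differentiableAt_rayValue he ⟨norm_nonneg x, mem_ball_zero_iff.1 hx⟩
  refine ((hasGradientAt_comp_norm hray.hasDerivAt fun h0 =>
    absurd h0 hx0).congr_of_eventuallyEq ?_).gradient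
  filter_upwards [Metric.isOpen_ball.mem_nhds hx] with y hy
  exact h.eq_rayValue he hy

theorem mul_rayFlux (h : IsPosRadialSolution n p K R u) (he : ‖e‖ = 1) (hr : r ∈ Ioo 0 R) :
    |deriv (rayValue u e) r| ^ (p - 2) * deriv (rayValue u e) r = -(r * rayFlux p u e r) := by
  have hnorm := norm_smul_of_norm_eq_one he hr.1.le
  have hr0 := hr.1.ne'
  have hre : r • e ≠ 0 := norm_ne_zero_iff.1 (hnorm.symm ▸ hr0)
  rw [rayFlux, flux_of_gradient_eq (h.gradient_eq he
    (smul_mem_ball he (Ioo_subset_Ico_self hr)) hre), hnorm, smul_smul, real_inner_smul_left,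
    real_inner_self_eq_norm_sq, he]
  field_simp

theorem flux_eq (h : IsPosRadialSolution n p K R u) (he : ‖e‖ = 1) (hx : x ∈ Metric.ball 0 R)
    (hx0 : x ≠ 0) : flux p u x = (-rayFlux p u e ‖x‖) • x := by
  have hnorm := norm_pos_iff.2 hx0
  rw [flux_of_gradient_eq (h.gradient_eq he hx hx0),
    h.mul_rayFlux he ⟨hnorm, mem_ball_zero_iff.1 hx⟩, neg_div, mul_div_cancel_left₀ _ hnorm.ne']

theorem differentiableAt_flux_smul (h : IsPosRadialSolution n p K R u) (he : ‖e‖ = 1)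
    (hr : r ∈ Ico 0 R) : DifferentiableAt ℝ (fun t : ℝ => flux p u (t • e)) r :=
  (h.flux_diff.differentiableAt (Metric.isOpen_ball.mem_nhds (smul_mem_ball he hr))).fun_comp' r
    (differentiableAt_id.smul_const e)

theorem differentiableAt_rayFlux (h : IsPosRadialSolution n p K R u) (he : ‖e‖ = 1)
    (hr : r ∈ Ioo 0 R) : DifferentiableAt ℝ (rayFlux p u e) r :=
  ((h.differentiableAt_flux_smul he (Ioo_subset_Ico_self hr)).inner ℝ
    (differentiableAt_const e)).neg.div differentiableAt_id hr.1.ne'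

theorem hasDerivAt_rayFlux (h : IsPosRadialSolution n p K R u) (he : ‖e‖ = 1)
    (hr : r ∈ Ioo 0 R) : HasDerivAt (rayFlux p u e)
      ((K r * rayValue u e r ^ (critExp n p - 1) - n * rayFlux p u e r) / r) r := by
  have hball := smul_mem_ball he (Ioo_subset_Ico_self hr)
  have hnorm := norm_smul_of_norm_eq_one he hr.1.le
  have hre : r • e ≠ 0 := norm_ne_zero_iff.1 (hnorm.symm ▸ hr.1.ne')
  have hdiff := (h.differentiableAt_rayFlux he hr).hasDerivAt
  have hflux : flux p u =ᶠ[𝓝 (r • e)] fun y => (-rayFlux p u e ‖y‖) • y := by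
    filter_upwards [Metric.isOpen_ball.mem_nhds hball, isOpen_ne.mem_nhds hre] with y hy hy0
    exact h.flux_eq he hy hy0
  have hdiv := divergence_of_hasFDerivAt <| (hasFDerivAt_comp_norm_smul
    (b := fun t => -rayFlux p u e t) (b' := -deriv (rayFlux p u e) r)
    (fun h0 => absurd h0 hre) fun _ => hnorm.symm ▸ hdiff.neg).congr_of_eventuallyEq hflux
  have heqn := h.eqn _ hball
  rw [pLaplacian, hdiv, mul_abs_rpow_of_pos (h.pos _ hball), hnorm] at heqn
  refine hdiff.congr_deriv ?_
  rw [eq_div_iff hr.1.ne', rayValue]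
  linarith

theorem tendsto_pow_mul_rayFlux (h : IsPosRadialSolution n p K R u) (he : ‖e‖ = 1) (hR : 0 < R)
    (hn : 1 < n) : Tendsto (fun r => r ^ n * rayFlux p u e r) (𝓝[>] 0) (𝓝 0) := by
  have hcont : ContinuousAt (fun r : ℝ => -(r ^ (n - 1) * inner ℝ (flux p u (r • e)) e)) 0 :=
    ((continuousAt_id.pow (n - 1)).mul
      ((h.differentiableAt_flux_smul he ⟨le_rfl, hR⟩).continuousAt.inner continuousAt_const)).neg
  have hlim := hcont.tendsto
  rw [zero_pow (Nat.sub_ne_zero_of_lt hn), zero_mul, neg_zero] at hlim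
  refine (hlim.mono_left nhdsWithin_le_nhds).congr' ?_
  filter_upwards [self_mem_nhdsWithin] with r hr
  have hr0 : r ≠ 0 := (mem_Ioi.1 hr).ne'
  rw [rayFlux, ← pow_sub_one_mul (Nat.ne_zero_of_lt hn)]
  field_simp

theorem rayValue_pos (h : IsPosRadialSolution n p K R u) (he : ‖e‖ = 1) (hr : r ∈ Ico 0 R) :
    0 < rayValue u e r :=
  h.pos _ (smul_mem_ball he hr)

theorem rayFlux_pos (h : IsPosRadialSolution n p K R u) (he : ‖e‖ = 1) (hn : 1 < n)
    (hK : ∀ r ∈ Ioo 0 R, 0 < K r) (hr : r ∈ Ioo 0 R) : 0 < rayFlux p u e r :=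
  pos_of_hasDerivAt_of_tendsto_pow_mul (Nat.ne_zero_of_lt hn) hr
    (fun _ ht => h.hasDerivAt_rayFlux he ht)
    (fun t ht => mul_pos (hK t ht)
      (Real.rpow_pos_of_pos (h.rayValue_pos he (Ioo_subset_Ico_self ht)) _))
    (h.tendsto_pow_mul_rayFlux he (hr.1.trans hr.2) hn)

theorem radialProfile {α : ℝ} (h : IsPosRadialSolution n p K R u) (he : ‖e‖ = 1) (hR : 0 < R)
    (hn : 1 < n) (hσp : σ * (p - 1) = 1) (hα : critExp n p = n * α)
    (hK : ∀ r ∈ Ioo 0 R, 0 < K r) :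
    RadialProfile n σ α K R (u 0) (rayValue u e) (rayFlux p u e) where
  K_pos := hK
  U_tendsto := by
    have hlim := (h.differentiableAt_rayValue he ⟨le_rfl, hR⟩).continuousAt.tendsto
    rw [rayValue, zero_smul] at hlim
    exact hlim.mono_left nhdsWithin_le_nhds
  w_tendsto := h.tendsto_pow_mul_rayFlux he hR hn
  U_pos _ hr := h.rayValue_pos he (Ioo_subset_Ico_self hr)
  U_deriv r hr :=
    (h.differentiableAt_rayValue he (Ioo_subset_Ico_self hr)).hasDerivAt.congr_deriv <|
      (abs_rpow_mul_self_eq_neg_iff hσp (mul_pos hr.1 (h.rayFlux_pos he hn hK hr))).1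
        (h.mul_rayFlux he hr)
  b_deriv _ hr := hα ▸ h.hasDerivAt_rayFlux he hr

theorem tendsto_rayValue (h : IsPosRadialSolution n p K R u) (he : ‖e‖ = 1) (hR : 0 < R) :
    Tendsto (rayValue u e) (𝓝[<] R) (𝓝 0) := by
  have hcont : ContinuousWithinAt (rayValue u e) (Icc 0 R) R :=
    ContinuousWithinAt.comp (f := fun t : ℝ => t • e)
      (h.cont _ (smul_mem_closedBall he ⟨hR.le, le_rfl⟩))
      (continuous_id.smul continuous_const).continuousWithinAt
      fun _ ht => smul_mem_closedBall he ht
  have hzero : rayValue u e R = 0 :=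
    h.boundary _ (mem_sphere_zero_iff_norm.2 (norm_smul_of_norm_eq_one he hR.le))
  refine hzero ▸ hcont.tendsto.mono_left (nhdsWithin_le_of_mem ?_)
  exact mem_of_superset (Ioo_mem_nhdsLT hR) Ioo_subset_Icc_self

end IsPosRadialSolution

/-! ### Existence and nonexistence -/

section Exponents

variable {n : ℕ} {p : ℝ}

theorem criticalExponents_of_lt (hp : 1 < p) (hpn : p < n) :
    CriticalExponents n (1 / (p - 1)) (p / (n - p)) where
  σ_pos := one_div_pos.2 (sub_pos.2 hp)
  α_pos := div_pos (by linarith) (sub_pos.2 hpn)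
  rel := by
    have := sub_pos.2 hp
    have := sub_pos.2 hpn
    field_simp
    ring

theorem critExp_eq : critExp n p = n * (p / (n - p)) :=
  mul_div_assoc _ _ _

theorem flatThreshold_eq (hp : 1 < p) :
    flatThreshold n p = (1 / (p - 1) + 1) / (p / (n - p)) := by
  have := sub_pos.2 hp
  have : p ≠ 0 := by linarith
  rw [flatThreshold, div_div_eq_mul_div]
  field_simp
  ring

theorem two_le_critExp (hpn : p < n) (hp : 2 * (n : ℝ) / (n + 2) ≤ p) : 2 ≤ critExp n p := by
  rw [div_le_iff₀ (by positivity)] at hp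
  rw [critExp, le_div_iff₀ (sub_pos.2 hpn)]
  linarith

end Exponents

namespace HasFlatness

variable {K : ℝ → ℝ} {ℓ : ℝ}

theorem exists_eventually_abs_sub_le (hK : DifferentiableOn ℝ K (Ioi 0)) (h : HasFlatness K ℓ) :
    ∃ A B : ℝ, 0 < A ∧ 0 < B ∧ ∀ ε > 0, ∀ᶠ r in 𝓝[>] 0,
      |K r - (A + B * r ^ ℓ)| ≤ ε * r ^ ℓ ∧
      |deriv K r - B * (ℓ * r ^ (ℓ - 1))| ≤ ε * r ^ (ℓ - 1) := by
  obtain ⟨-, A, B, hA, hB, h, hKh, hlim⟩ := h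
  refine ⟨A, B, hA, hB, fun ε hε => ?_⟩
  filter_upwards [hlim.eventually_lt_const hε, self_mem_nhdsWithin] with r hlt hr
  rw [mem_Ioi] at hr
  rw [div_lt_iff₀ (by positivity)] at hlt
  have hrem : h =ᶠ[𝓝 r] fun t => K t - (A + B * t ^ ℓ) := by
    filter_upwards [Ioi_mem_nhds hr] with t ht
    rw [hKh t (mem_Ioi.1 ht).le, add_sub_cancel_left]
  have hderiv : deriv h r = deriv K r - B * (ℓ * r ^ (ℓ - 1)) :=
    (((hK.differentiableAt (Ioi_mem_nhds hr)).hasDerivAt.sub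
      (((Real.hasDerivAt_rpow_const (Or.inl hr.ne')).const_mul B).const_add
        A)).congr_of_eventuallyEq hrem).deriv
  rw [← hrem.eq_of_nhds, ← hderiv, Real.rpow_sub_one hr.ne', ← mul_div_assoc, le_div_iff₀ hr]
  have := abs_nonneg (h r)
  have := mul_nonneg hr.le (abs_nonneg (deriv h r))
  constructor <;> linarith

theorem exists_monotoneWeight (hK : DifferentiableOn ℝ K (Ioi 0)) (h : HasFlatness K ℓ) :
    ∃ A M c C ρ : ℝ, 0 < c ∧ 0 < C ∧ 0 < ρ ∧ ρ ≤ 1 ∧ MonotoneWeight K ρ A M ∧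
      ∀ r ∈ Ioo 0 ρ, c * r ^ (ℓ - 1) ≤ deriv K r ∧ deriv K r ≤ C * r ^ (ℓ - 1) := by
  have hℓ := h.1
  obtain ⟨A, B, hA, hB, hnear⟩ := h.exists_eventually_abs_sub_le hK
  have hε : 0 < min B (B * ℓ / 2) := lt_min hB (by positivity)
  obtain ⟨ρ, hρ, hsub⟩ := mem_nhdsGT_iff_exists_Ioo_subset.1 (hnear _ hε)
  have hbound : ∀ r ∈ Ioo 0 (min ρ 1), (A ≤ K r ∧ K r ≤ A + 2 * B) ∧
      B * ℓ / 2 * r ^ (ℓ - 1) ≤ deriv K r ∧ deriv K r ≤ 2 * (B * ℓ) * r ^ (ℓ - 1) := by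
    intro r hr
    obtain ⟨hKr, hKr'⟩ := hsub ⟨hr.1, hr.2.trans_le (min_le_left _ _)⟩
    have hr0 := hr.1
    have hrℓ : r ^ ℓ ≤ 1 := Real.rpow_le_one hr0.le (hr.2.le.trans (min_le_right _ _)) hℓ.le
    replace hKr := abs_le.1 (hKr.trans (mul_le_mul_of_nonneg_right (min_le_left _ _)
      (by positivity)))
    replace hKr' := abs_le.1 (hKr'.trans (mul_le_mul_of_nonneg_right (min_le_right _ _)
      (by positivity)))
    have hBr : B * r ^ ℓ ≤ B := mul_le_of_le_one_right hB.le hrℓ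
    have : 0 < B * ℓ * r ^ (ℓ - 1) := by positivity
    exact ⟨⟨by linarith, by linarith⟩, by linarith, by linarith⟩
  refine ⟨A, A + 2 * B, B * ℓ / 2, 2 * (B * ℓ), min ρ 1, by positivity, by positivity,
    lt_min hρ one_pos, min_le_right _ _, ?_, fun r hr => (hbound r hr).2⟩
  exact
    { A_pos := hA
      lower := fun r hr => (hbound r hr).1.1
      upper := fun r hr => (hbound r hr).1.2
      differentiableAt := fun r hr => hK.differentiableAt (Ioi_mem_nhds hr.1)
      deriv_nonneg := fun r hr =>
        (mul_nonneg (by positivity) (Real.rpow_nonneg hr.1.le _)).trans (hbound r hr).2.1 }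

end HasFlatness

theorem exists_isPosRadialSolution {n : ℕ} {p : ℝ} (hp1 : 1 < p) (hpn : p < n)
    (hq2 : 2 ≤ critExp n p) (hp2 : p ≤ 2) {K : ℝ → ℝ} (hK : Admissible K) {ℓ : ℝ}
    (hℓ : HasFlatness K ℓ) (hlt : ℓ < flatThreshold n p) {R : ℝ} (hR : 0 < R) :
    ∃ u, IsPosRadialSolution n p K R u := by
  have E := criticalExponents_of_lt hp1 hpn
  have hσ : 1 ≤ 1 / (p - 1) := (one_le_div (sub_pos.2 hp1)).2 (by linarith)
  have hσp : 1 / (p - 1) * (p - 1) = 1 := one_div_mul_cancel (sub_pos.2 hp1).ne'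
  obtain ⟨A, M, c, _, ρ, hc, -, hρ, -, hW, hK'⟩ :=
    hℓ.exists_monotoneWeight (hK.contDiff.differentiableOn one_ne_zero)
  rw [flatThreshold_eq hp1] at hlt
  obtain ⟨D, hnot, hD⟩ := ((RadialProfile.eventually_not_radialProfile E
    (hW.mono (min_le_left ρ R)) (lt_min hρ hR) hc hℓ.1 hlt fun r hr =>
      (hK' r ⟨hr.1, hr.2.trans_le (min_le_left ρ R)⟩).1).and (eventually_gt_atTop 0)).exists
  have hcross : ∀ M U b, IsShootingSolution n (1 / (p - 1)) (critExp n p - 1) K R M D U b →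
      U R ≤ 0 := fun M U b h => by
    by_contra! hUR
    rw [critExp_eq] at h
    exact hnot U b ((h.radialProfile E.ne_zero (fun r hr => hK.pos r hr.1.le) hUR.le).mono
      (min_le_right ρ R))
  obtain ⟨M, d, U, b, hU, hUR⟩ := exists_isShootingSolution_eq_zero E.ne_zero hσ (by linarith)
    (critExp_eq (n := n) (p := p) ▸ E.one_lt_critical_sub_one_mul) hR
    (hK.cont.mono Icc_subset_Ici_self) (fun r hr => hK.pos r hr.1) hD hcross
  exact ⟨_, hU.isPosRadialSolution E.σ_pos hσp hUR⟩

theorem exists_radius_not_isPosRadialSolution {n : ℕ} {p : ℝ} (hp1 : 1 < p) (hpn : p < n)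
    {K : ℝ → ℝ} (hK : Admissible K) {ℓ : ℝ} (hℓ : HasFlatness K ℓ)
    (hle : flatThreshold n p ≤ ℓ) :
    ∃ R₀ : ℝ, 0 < R₀ ∧ ∀ R : ℝ, 0 < R → R < R₀ → ¬ ∃ u, IsPosRadialSolution n p K R u := by
  have E := criticalExponents_of_lt hp1 hpn
  have hn : 1 < n := by exact_mod_cast hp1.trans hpn
  have hσp : 1 / (p - 1) * (p - 1) = 1 := one_div_mul_cancel (sub_pos.2 hp1).ne'
  obtain ⟨A, M, _, C, ρ, -, hC, hρ, hρ1, hW, hK'⟩ :=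
    hℓ.exists_monotoneWeight (hK.contDiff.differentiableOn one_ne_zero)
  obtain ⟨R₁, hR₁, hmain⟩ :=
    RadialProfile.exists_radius_le_of_tendsto_zero E hW.A_pos hC M
  refine ⟨min ρ R₁, lt_min hρ hR₁, fun R hR hRlt ⟨u, hu⟩ => ?_⟩
  have hRρ : R < ρ := hRlt.trans_le (min_le_left _ _)
  obtain ⟨e, he⟩ : ∃ e : EuclideanSpace ℝ (Fin n), ‖e‖ = 1 :=
    ⟨EuclideanSpace.single ⟨0, by omega⟩ 1, by simp⟩
  have hprofile := hu.radialProfile he hR hn hσp critExp_eq fun r hr => hK.pos r hr.1.le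
  have hderiv : ∀ r ∈ Ioo 0 R, deriv K r ≤ C * r ^ ((1 / (p - 1) + 1) / (p / (n - p)) - 1) :=
    fun r hr => by
      refine (hK' r ⟨hr.1, hr.2.trans hRρ⟩).2.trans (mul_le_mul_of_nonneg_left ?_ hC.le)
      rw [← flatThreshold_eq hp1]
      exact Real.rpow_le_rpow_of_exponent_ge hr.1 (by linarith [hr.2]) (by linarith)
  exact (hRlt.trans_le (min_le_right _ _)).not_ge
    (hmain hprofile hR (hW.mono hRρ.le) hderiv (hu.tendsto_rayValue he hR))

end PLaplace

end

theorem theorem1_general (n : ℕ) (p : ℝ) (hp1 : 1 < p) (hpn : p < n)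
    (K : ℝ → ℝ) (hK : PLaplace.Admissible K) (ℓ : ℝ) (hℓ : PLaplace.HasFlatness K ℓ) :
    (2 * (n : ℝ) / (n + 2) ≤ p → p ≤ 2 → ℓ < PLaplace.flatThreshold n p →
      ∀ R : ℝ, 0 < R → ∃ u, PLaplace.IsPosRadialSolution n p K R u) ∧
    (PLaplace.flatThreshold n p ≤ ℓ →
      ∃ R₀ : ℝ, 0 < R₀ ∧ ∀ R : ℝ, 0 < R → R < R₀ →
        ¬ ∃ u, PLaplace.IsPosRadialSolution n p K R u) :=
  ⟨fun hp_low hp2 hlt _ hR => PLaplace.exists_isPosRadialSolution hp1 hpn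
      (PLaplace.two_le_critExp hpn hp_low) hp2 hK hℓ hlt hR,
    fun hle => PLaplace.exists_radius_not_isPosRadialSolution hp1 hpn hK hℓ hle⟩

theorem theorem1 (n : ℕ) (p : ℝ) (hp1 : 1 < p) (hpn : p < n)
    (hp_low : 2 * (n : ℝ) / (n + 2) ≤ p) (hp2 : p ≤ 2)
    (K : ℝ → ℝ) (hK : PLaplace.Admissible K)
    (ℓ : ℝ) (hℓ : PLaplace.HasFlatness K ℓ) :
    (ℓ < PLaplace.flatThreshold n p →
      ∀ R : ℝ, 0 < R → ∃ u, PLaplace.IsPosRadialSolution n p K R u) ∧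
    (PLaplace.flatThreshold n p ≤ ℓ →
      ∃ R₀ : ℝ, 0 < R₀ ∧ ∀ R : ℝ, 0 < R → R < R₀ →
        ¬ ∃ u, PLaplace.IsPosRadialSolution n p K R u) := by
  have h := theorem1_general n p hp1 hpn K hK ℓ hℓ
  exact ⟨h.1 hp_low hp2, h.2⟩
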